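/- Fix $q\ge 1$ (the alphabet size). For probability distributions $f,g$ on a $q$-point set let $\mathcal H^2(f\|g)=\frac12\sum_i(\sqrt{f(i)}-\sqrt{g(i)})^2$. An instance consists of a partition of $[n]$ into $k$ nonempty clusters and of two distributions $f_+,f_-$ on a fixed set of $q$ points. An algorithm is given $n$ and a random matrix $W=(w_{u,v})_{1\le u<v\le n}$ with independent entries, $w_{u,v}\sim f_+$ if $u,v$ lie in the same cluster and $w_{u,v}\sim f_-$ otherwise. It may toss fair coins (independent of $W$) and may adaptively query an oracle, which tells for a pair $u,v$ whether the two elements are in the same cluster. It does not know $k$, $f_+$, $f_-$ or the partition. Write $B=\min\left(nk,\ \frac{k^2\log n}{\mathcal H^2(f_+\|f_-)}\right)$, with $B=nk$ if $f_+=f_-$. (1) (Monte Carlo.) For every $\varepsilon>0$ there are a randomized algorithm, a constant $C$ and a function $\delta(n)=o(1/n)$, depending only on $q$ and $\varepsilon$, such that the algorithm always runs in time polynomial in $n$, and for every instance all of whose clusters have at most $(1-\varepsilon)n$ elements it holds with probability at least $1-\delta(n)$ that the algorithm outputs exactly the true clusters and makes at most $C\,B$ oracle queries. (2) (Las Vegas.)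 There are an algorithm, a constant $C$ and a function $\delta(n)=o(1/n)$, depending only on $q$, such that the algorithm always runs in time polynomial in $n$ and always outputs exactly the true clusters, and for every instance it makes at most $C\,(n\log n+B)$ oracle queries with probability at least $1-\delta(n)$. Running time is the logarithmic cost of a random-access program. -/

import Mathlib

open MeasureTheory

namespace QueryCluster

/-! ### Computational model

Probabilistic oracle programs over a memory of arrays of natural numbers, in a while-language with
logarithmic cost: evaluating a node of an expression costs one plus the bit length of its value, so
that running times agree, up to polynomial factors, with those of Turing machines. -/

/-- Binary operations; subtraction is truncated, division is rounded down, and the comparisons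
return `1` or `0`. -/
inductive Op
  | add | sub | mul | div | lt | eq

def Op.eval : Op → ℕ → ℕ → ℕ
  | .add, x, y => x + y
  | .sub, x, y => x - y
  | .mul, x, y => x * y
  | .div, x, y => x / y
  | .lt, x, y => if x < y then 1 else 0
  | .eq, x, y => if x = y then 1 else 0

/-- `cell a e` is the entry of the array number `a` at the position given by the value of `e`. -/
inductive Expr
  | lit (m : ℕ)
  | cell (a : ℕ) (e : Expr)
  | bin (o : Op) (e₁ e₂ : Expr)

def Expr.val (mem : ℕ → ℕ → ℕ) : Expr → ℕ
  | .lit m => m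
  | .cell a e => mem a (e.val mem)
  | .bin o e₁ e₂ => o.eval (e₁.val mem) (e₂.val mem)

def Expr.cost (mem : ℕ → ℕ → ℕ) : Expr → ℕ
  | .lit m => 1 + m.size
  | .cell a e => 1 + (mem a (e.val mem)).size + e.cost mem
  | .bin o e₁ e₂ => 1 + (o.eval (e₁.val mem) (e₂.val mem)).size + e₁.cost mem + e₂.cost mem

/-- Programs. The destination of `assign`, `query` and `flip` is the entry number `i` of the
array `a`. -/
inductive Prog
  | skip
  | assign (a : ℕ) (i e : Expr)
  | seq (c d : Prog)
  | cond (b : Expr) (c d : Prog)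
  | loop (b : Expr) (c : Prog)
  /-- ask the oracle whether `u` and `v` lie in the same cluster, and store the answer -/
  | query (a : ℕ) (i u v : Expr)
  /-- store a fair random bit -/
  | flip (a : ℕ) (i : Expr)

/-- Memory, elapsed time, number of oracle queries made, number of random bits used. -/
structure State where
  mem : ℕ → ℕ → ℕ
  time : ℕ
  queries : ℕ
  coins : ℕ

def State.tick (s : State) (t : ℕ) : State := { s with time := s.time + t }

def State.write (s : State) (a i x : ℕ) : State :=
  { s with mem := Function.update s.mem a (Function.update (s.mem a) i x) }

/-- `Exec O ω c s t`: with oracle `O` and random tape `ω`, the program `c` started in the state `s`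
halts in the state `t`. -/
inductive Exec (O : ℕ → ℕ → Bool) (ω : ℕ → Bool) : Prog → State → State → Prop
  | skip (s : State) : Exec O ω .skip s (s.tick 1)
  | assign (a : ℕ) (i e : Expr) (s : State) :
      Exec O ω (.assign a i e) s
        ((s.tick (1 + i.cost s.mem + e.cost s.mem)).write a (i.val s.mem) (e.val s.mem))
  | seq {c d : Prog} {s t r : State} (hc : Exec O ω c s t) (hd : Exec O ω d t r) :
      Exec O ω (.seq c d) s r
  | cond_true {b : Expr} {c d : Prog} {s t : State} (hb : b.val s.mem ≠ 0)
      (hc : Exec O ω c (s.tick (1 + b.cost s.mem)) t) : Exec O ω (.cond b c d) s t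
  | cond_false {b : Expr} {c d : Prog} {s t : State} (hb : b.val s.mem = 0)
      (hd : Exec O ω d (s.tick (1 + b.cost s.mem)) t) : Exec O ω (.cond b c d) s t
  | loop_true {b : Expr} {c : Prog} {s t r : State} (hb : b.val s.mem ≠ 0)
      (hc : Exec O ω c (s.tick (1 + b.cost s.mem)) t) (hl : Exec O ω (.loop b c) t r) :
      Exec O ω (.loop b c) s r
  | loop_false {b : Expr} {c : Prog} {s : State} (hb : b.val s.mem = 0) :
      Exec O ω (.loop b c) s (s.tick (1 + b.cost s.mem))
  | query (a : ℕ) (i u v : Expr) (s : State) :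
      Exec O ω (.query a i u v) s
        { (s.tick (1 + i.cost s.mem + u.cost s.mem + v.cost s.mem)).write a (i.val s.mem)
            (O (u.val s.mem) (v.val s.mem)).toNat with queries := s.queries + 1 }
  | flip (a : ℕ) (i : Expr) (s : State) :
      Exec O ω (.flip a i) s
        { (s.tick (1 + i.cost s.mem)).write a (i.val s.mem) (ω s.coins).toNat with
          coins := s.coins + 1 }

/-- A program has at most one final state, so "the run halts in a state with property `P`" may be
expressed by `∃ t, Exec O ω c s t ∧ P t`. -/
theorem Exec.unique {O : ℕ → ℕ → Bool} {ω : ℕ → Bool} {c : Prog} {s t t' : State}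
    (h : Exec O ω c s t) (h' : Exec O ω c s t') : t = t' := by
  induction h generalizing t' with
  | skip s => cases h'; rfl
  | assign a i e s => cases h'; rfl
  | seq _ _ ih₁ ih₂ => cases h' with | seq hc hd => cases ih₁ hc; exact ih₂ hd
  | cond_true hb _ ih =>
    cases h' with
    | cond_true _ hc => exact ih hc
    | cond_false hb' _ => exact absurd hb' hb
  | cond_false hb _ ih =>
    cases h' with
    | cond_true hb' _ => exact absurd hb hb'
    | cond_false _ hc => exact ih hc
  | loop_true hb _ _ ih₁ ih₂ =>
    cases h' with
    | loop_true _ hc hl => cases ih₁ hc; exact ih₂ hl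
    | loop_false hb' => exact absurd hb' hb
  | loop_false hb =>
    cases h' with
    | loop_true hb' _ _ => exact absurd hb hb'
    | loop_false _ => rfl
  | query a i u v s => cases h'; rfl
  | flip a i s => cases h'; rfl

/-! ### The clustering problem

The clusters on the elements `Fin n` are the fibres of a surjective map `c : Fin n → Fin k`. -/

/-- Positions of the upper-triangular similarity matrix. -/
abbrev Pair (n : ℕ) : Type := {p : Fin n × Fin n // p.1 < p.2}

/-- The oracle of a clustering: `true` stands for the answer `+1`, `false` for `-1`. -/
def oracle {n k : ℕ} (c : Fin n → Fin k) (u v : ℕ) : Bool :=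
  if h : u < n ∧ v < n then decide (c ⟨u, h.1⟩ = c ⟨v, h.2⟩) else false

/-- The similarity matrix as an array: the entry `(u, v)`, `u < v`, is at position `u * n + v`. -/
def sideArray {n q : ℕ} (W : Pair n → Fin q) (i : ℕ) : ℕ :=
  if h : i / n < n ∧ i % n < n ∧ i / n < i % n then
    W ⟨(⟨i / n, h.1⟩, ⟨i % n, h.2.1⟩), h.2.2⟩
  else 0

/-- Initially array `0` holds `n` at position `0`, array `1` holds the similarity matrix, and
everything else is zero. -/
def initState {n q : ℕ} (W : Pair n → Fin q) : State where
  mem a i := if a = 0 then (if i = 0 then n else 0) else if a = 1 then sideArray W i else 0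
  time := 0
  queries := 0
  coins := 0

/-- The run of the program `P` on similarity matrix `W`, clustering `c` and random tape `ω` halts
in the state `t`. -/
def HaltsIn {n k q : ℕ} (P : Prog) (c : Fin n → Fin k) (W : Pair n → Fin q) (ω : ℕ → Bool)
    (t : State) : Prop :=
  Exec (oracle c) ω P (initState W) t

/-- The output, a cluster label for each element in array `2`, is the correct clustering. -/
def Recovers {n k : ℕ} (t : State) (c : Fin n → Fin k) : Prop :=
  ∀ u v : Fin n, t.mem 2 u = t.mem 2 v ↔ c u = c v

/-- On inputs with alphabet size `q`, the program halts within a number of steps polynomial in `n`,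
for all similarity matrices, all clusterings and all outcomes of the random bits. -/
def PolyTime (q : ℕ) (P : Prog) : Prop :=
  ∃ p : Polynomial ℕ, ∀ (n k : ℕ) (c : Fin n → Fin k) (W : Pair n → Fin q) (ω : ℕ → Bool),
    ∃ t, HaltsIn P c W ω t ∧ t.time ≤ p.eval n

noncomputable section

/-- Squared Hellinger divergence. -/
def hellingerSq {q : ℕ} (f g : PMF (Fin q)) : ℝ :=
  (1 / 2) * ∑ i, (√(f i).toReal - √(g i).toReal) ^ 2

/-- Law of the similarity matrix: independent entries, distributed as `fp` within clusters and as
`fm` between different clusters. -/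
def sideLaw {n k q : ℕ} (c : Fin n → Fin k) (fp fm : PMF (Fin q)) : Measure (Pair n → Fin q) :=
  Measure.pi fun p : Pair n => (if c p.1.1 = c p.1.2 then fp else fm).toMeasure

/-- Law of a sequence of independent fair bits. -/
def coinLaw : Measure (ℕ → Bool) :=
  Measure.infinitePi fun _ : ℕ => (PMF.uniformOfFintype Bool).toMeasure

/-- Joint law of the similarity matrix and the (independent) random bits of the program. -/
def jointLaw {n k q : ℕ} (c : Fin n → Fin k) (fp fm : PMF (Fin q)) :
    Measure ((Pair n → Fin q) × (ℕ → Bool)) :=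
  (sideLaw c fp fm).prod coinLaw

/-- `min (n k, k² log n / h)`, where the second term is infinite for `h = 0`. -/
def queryBound (n k : ℕ) (h : ℝ) : ℝ :=
  if h = 0 then n * k else min ((n : ℝ) * k) ((k : ℝ) ^ 2 * Real.log n / h)

end

end QueryCluster

/-!
The elements are processed in order. An element without a cluster is classified by queries to one
representative of each known cluster. Then, for each symbol, the similarities of an element `v` to
the processed members of a cluster with this symbol are counted. The count is a sub-Poisson
variable, and the square root stabilises its variance: it is within `√(5 L)` of the square root of
its mean, `L` being the bit length of `n`, except with probability `2 exp (-5 L)`, so that this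
holds for all counts at once except with probability `O(1 / n ^ 2)`. Some symbol contributes
at least `2 H² / q` to the sum `2 H²` of the squared differences of the square roots of the
probabilities. Hence, after order of `q L / H²` members of a cluster, the counts for this symbol
separate the cluster from the other elements, and its remaining members are found without queries.
Conversely, no separation is ever believed in by mistake: an outside element whose count differs
much from that of the representative shows on which side every other element lies.

Therefore queries are spent only on the first `O(q L / H²)` elements of each cluster, at most `k`
for each of them. In the Las Vegas variant each member found in this way is confirmed by one query,
and unconfirmed ones are left to be classified later; if there is a single cluster, then each
element costs at most one query anyway. No random bits are needed.
-/

namespace QueryCluster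

/-! ### Commands with bounded loops -/

/-- The part of a state that determines the further course of a program without random bits. -/
structure Store where
  mem : ℕ → ℕ → ℕ
  queries : ℕ

namespace Store

/-- Writing `x` to entry `i` of the array `a`. -/
def set (s : Store) (a i x : ℕ) : Store :=
  { s with mem := Function.update s.mem a (Function.update (s.mem a) i x) }

theorem mem_set (s : Store) (a i x b j : ℕ) :
    (s.set a i x).mem b j = if b = a ∧ j = i then x else s.mem b j := by
  by_cases hb : b = a
  · subst hb
    by_cases hj : j = i <;> simp [set, hj]
  · simp [set, hb]

@[simp] theorem mem_set_self (s : Store) (a i x : ℕ) :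
    (s.set a i x).mem a = Function.update (s.mem a) i x :=
  Function.update_self ..

@[simp] theorem mem_set_of_ne (s : Store) {a b : ℕ} (h : b ≠ a) (i x : ℕ) :
    (s.set a i x).mem b = s.mem b :=
  Function.update_of_ne h ..

@[simp] theorem queries_set (s : Store) (a i x : ℕ) : (s.set a i x).queries = s.queries := rfl

/-- The store before the iteration number `i` of a loop with variable `x` and body `f`. -/
def loop (x : ℕ) (f : Store → Store) (s : Store) : ℕ → Store
  | 0 => s.set x 0 0
  | i + 1 => (f (s.loop x f i)).set x 0 (i + 1)

end Store

/-- The variable stored in entry `0` of the array `a`. -/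
abbrev reg (a : ℕ) : Expr := .cell a (.lit 0)

/-- Programs without random bits in which every loop runs through the numbers below the input
size. -/
inductive Cmd
  | assign (a : ℕ) (i e : Expr)
  | seq (c d : Cmd)
  /-- run `c` if the value of `b` is not zero -/
  | guard (b : Expr) (c : Cmd)
  | query (a : ℕ) (i u v : Expr)
  /-- run `c` with `reg x` ranging over the numbers below `n` -/
  | forall_lt (x : ℕ) (c : Cmd)

namespace Cmd

/-- The test that controls a loop with variable `x`. -/
def loopTest (x : ℕ) : Expr := .bin .lt (reg x) (reg 0)

/-- The value of the variable `x` in the next pass through a loop. -/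
def loopNext (x : ℕ) : Expr := .bin .add (reg x) (.lit 1)

/-- The translation of a command into the programming language of the model. -/
def toProg : Cmd → Prog
  | assign a i e => .assign a i e
  | seq c d => .seq c.toProg d.toProg
  | guard b c => .cond b c.toProg .skip
  | query a i u v => .query a i u v
  | forall_lt x c =>
    .seq (.assign x (.lit 0) (.lit 0))
      (.loop (loopTest x) (.seq c.toProg (.assign x (.lit 0) (loopNext x))))

/-- Effect of a command with the oracle `O`. -/
def run (O : ℕ → ℕ → Bool) : Cmd → Store → Store
  | assign a i e, s => s.set a (i.val s.mem) (e.val s.mem)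
  | seq c d, s => d.run O (c.run O s)
  | guard b c, s => if b.val s.mem = 0 then s else c.run O s
  | query a i u v, s =>
    { s.set a (i.val s.mem) (O (u.val s.mem) (v.val s.mem)).toNat with queries := s.queries + 1 }
  | forall_lt x c, s => s.loop x (c.run O) (s.mem 0 0)

/-- The command may write to the array `a`. -/
def Writes : Cmd → ℕ → Prop
  | assign a _ _, b => b = a
  | seq c d, b => c.Writes b ∨ d.Writes b
  | guard _ c, b => c.Writes b
  | query a _ _ _, b => b = a
  | forall_lt x c, b => b = x ∨ c.Writes b

end Cmd

/-- Expressions without products: their bit length exceeds that of the memory entries by at most a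
constant, so that storing their values repeatedly does not lead to exponential growth. -/
def Expr.Additive : Expr → Prop
  | .lit _ => True
  | .cell _ _ => True
  | .bin .mul _ _ => False
  | .bin _ e₁ e₂ => e₁.Additive ∧ e₂.Additive

namespace Cmd

/-- The input size and the loop variables are not overwritten, and only values of additive
expressions are stored. -/
def Ok : Cmd → Prop
  | assign a _ e => a ≠ 0 ∧ e.Additive
  | seq c d => c.Ok ∧ d.Ok
  | guard _ c => c.Ok
  | query a _ _ _ => a ≠ 0
  | forall_lt x c => x ≠ 0 ∧ c.Ok ∧ ¬ c.Writes x

variable {O : ℕ → ℕ → Bool} {ω : ℕ → Bool} {c d : Cmd} {s : Store}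

theorem Ok.not_writes_zero (h : c.Ok) : ¬ c.Writes 0 := by
  induction c with
  | assign a i e => exact fun h' => h.1 h'.symm
  | seq c d hc hd => exact fun h' => h'.elim (hc h.1) (hd h.2)
  | guard b c hc => exact hc h
  | query a i u v => exact fun h' => h h'.symm
  | forall_lt x c hc => exact fun h' => h'.elim (fun h' => h.1 h'.symm) (hc h.2.1)

theorem mem_loop_of_forall {x a : ℕ} {f : Store → Store} (hx : a ≠ x)
    (hf : ∀ t, (f t).mem a = t.mem a) (s : Store) (i : ℕ) : (s.loop x f i).mem a = s.mem a := by
  induction i with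
  | zero => exact s.mem_set_of_ne hx ..
  | succ i ih => rw [Store.loop, Store.mem_set_of_ne _ hx, hf, ih]

theorem mem_run_of_not_writes {a : ℕ} (h : ¬ c.Writes a) (s : Store) :
    (c.run O s).mem a = s.mem a := by
  induction c generalizing s with
  | assign b i e => exact s.mem_set_of_ne h ..
  | seq c d hc hd => exact (hd (mt Or.inr h) _).trans (hc (mt Or.inl h) s)
  | guard b c hc =>
    rw [run]
    split_ifs
    · rfl
    · exact hc h s
  | query b i u v => exact s.mem_set_of_ne h ..
  | forall_lt x c hc => exact mem_loop_of_forall (mt Or.inl h) (hc (mt Or.inr h)) s _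

theorem Ok.mem_run_zero (h : c.Ok) (s : Store) : (c.run O s).mem 0 = s.mem 0 :=
  mem_run_of_not_writes h.not_writes_zero s

theorem mem_loop_of_not_writes {x a : ℕ} (h : ¬ (forall_lt x c).Writes a) (s : Store) (i : ℕ) :
    (s.loop x (c.run O) i).mem a = s.mem a :=
  mem_loop_of_forall (mt Or.inl h) (fun t => mem_run_of_not_writes (mt Or.inr h) t) s i

theorem mem_loop_var (x : ℕ) (f : Store → Store) (s : Store) (i : ℕ) :
    (s.loop x f i).mem x 0 = i := by
  cases i <;> simp [Store.loop]

theorem run_forall_lt_of_invariant {x n : ℕ} (hn : s.mem 0 0 = n) (I : ℕ → Store → Prop)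
    (hI : ∀ i t y, I i t → I i (t.set x 0 y)) (h0 : I 0 s)
    (hstep : ∀ i < n, ∀ t : Store, t.mem x 0 = i →
      (∀ a, ¬ (forall_lt x c).Writes a → t.mem a = s.mem a) → I i t → I (i + 1) (c.run O t)) :
    I n ((forall_lt x c).run O s) := by
  suffices H : ∀ i ≤ n, I i (s.loop x (c.run O) i) from hn ▸ H _ hn.le
  intro i
  induction i with
  | zero => exact fun _ => hI _ _ _ h0
  | succ i ih =>
    exact fun hi => hI _ _ _ (hstep i hi _ (mem_loop_var x _ s i)
      (fun a ha => mem_loop_of_not_writes ha s i) (ih (Nat.le_of_succ_le hi)))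

/-! ### Running time of commands -/

/-- The cost of the test in front of a pass through a loop with variable `x`, of the loop body,
which has the effect `f` and the cost `g`, and of the increment of the variable. -/
def passCost (x : ℕ) (f : Store → Store) (g : Store → ℕ) (s : Store) : ℕ :=
  1 + (loopTest x).cost s.mem + g s + (2 + (loopNext x).cost (f s).mem)

/-- The time that a command takes. -/
def cost (O : ℕ → ℕ → Bool) : Cmd → Store → ℕ
  | assign _ i e, s => 1 + i.cost s.mem + e.cost s.mem
  | seq c d, s => c.cost O s + d.cost O (c.run O s)
  | guard b c, s => 1 + b.cost s.mem + if b.val s.mem = 0 then 1 else c.cost O s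
  | query _ i u v, s => 1 + i.cost s.mem + u.cost s.mem + v.cost s.mem
  | forall_lt x c, s =>
    3 + ∑ i ∈ Finset.range (s.mem 0 0),
        passCost x (c.run O) (c.cost O) (s.loop x (c.run O) i) +
      (1 + (loopTest x).cost (s.loop x (c.run O) (s.mem 0 0)).mem)

end Cmd

/-- The store of a state. -/
abbrev State.store (s : State) : Store := ⟨s.mem, s.queries⟩

/-- The state that is reached from `s` in time `t` if the new store is `r`. -/
def State.after (s : State) (r : Store) (t : ℕ) : State := ⟨r.mem, s.time + t, r.queries, s.coins⟩

theorem State.tick_after (s : State) (r : Store) (t t' : ℕ) :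
    (s.after r t).tick t' = s.after r (t + t') := by
  simp only [after, tick, add_assoc]

namespace Cmd

theorem val_loopTest_eq_zero {m : ℕ → ℕ → ℕ} {x : ℕ} :
    (loopTest x).val m = 0 ↔ m 0 0 ≤ m x 0 := by
  by_cases h : m x 0 < m 0 0 <;> simp [loopTest, Expr.val, Op.eval, h, le_of_not_gt]

theorem exec_pass {x i : ℕ} (hok : (forall_lt x c).Ok)
    (hc : ∀ s, Exec O ω c.toProg s (s.after (c.run O s.store) (c.cost O s.store))) (s : State)
    {r : Store} (hx : r.mem x 0 = i) (t : ℕ) :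
    Exec O ω (.seq c.toProg (.assign x (.lit 0) (loopNext x)))
      ((s.after r t).tick (1 + (loopTest x).cost r.mem))
      (s.after ((c.run O r).set x 0 (i + 1)) (t + passCost x (c.run O) (c.cost O) r)) := by
  have hnext : (loopNext x).val (c.run O r).mem = i + 1 := by
    simp [loopNext, Expr.val, Op.eval, mem_run_of_not_writes hok.2.2, hx]
  convert Exec.seq (hc ((s.after r t).tick _)) (Exec.assign ..) using 1
  simp only [State.after, State.store, State.tick, State.write, Store.set, Expr.val, Expr.cost,
    Nat.size_zero, hnext, passCost]
  congr 1
  ring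

theorem exec_loop {x n : ℕ} (hok : (forall_lt x c).Ok)
    (hc : ∀ s, Exec O ω c.toProg s (s.after (c.run O s.store) (c.cost O s.store))) (s : State)
    {r : Store} (hn : r.mem 0 0 = n) {i : ℕ} (hi : i ≤ n) (t : ℕ) :
    Exec O ω (.loop (loopTest x) (.seq c.toProg (.assign x (.lit 0) (loopNext x))))
      (s.after (r.loop x (c.run O) i) t)
      (s.after (r.loop x (c.run O) n)
        (t + ∑ j ∈ Finset.Ico i n, passCost x (c.run O) (c.cost O) (r.loop x (c.run O) j) +
          (1 + (loopTest x).cost (r.loop x (c.run O) n).mem))) := by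
  have h0 (j) : (r.loop x (c.run O) j).mem 0 0 = n := by
    rw [mem_loop_of_forall hok.1.symm hok.2.1.mem_run_zero, hn]
  induction hi using Nat.decreasingInduction generalizing t with
  | self =>
    have htest : (loopTest x).val (r.loop x (c.run O) n).mem = 0 :=
      val_loopTest_eq_zero.2 ((h0 n).trans (mem_loop_var ..).symm).le
    rw [Finset.Ico_self, Finset.sum_empty, add_zero, ← State.tick_after]
    exact .loop_false htest
  | of_succ i hi ih =>
    rw [Finset.sum_eq_sum_Ico_succ_bot hi, ← add_assoc t]
    refine .loop_true ?_ (exec_pass hok hc s (mem_loop_var x _ r i) t) (ih _)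
    rw [Ne, val_loopTest_eq_zero, not_le]
    exact (mem_loop_var x _ r i).trans_lt (hi.trans_eq (h0 i).symm)

theorem exec_toProg {c : Cmd} (hok : c.Ok) (s : State) :
    Exec O ω c.toProg s (s.after (c.run O s.store) (c.cost O s.store)) := by
  induction c generalizing s with
  | assign a i e =>
    rw [toProg]
    convert Exec.assign a i e s using 1
    simp only [State.after, State.tick, State.write, run, Store.set, cost, add_assoc]
  | query a i u v =>
    rw [toProg]
    convert Exec.query a i u v s using 1
    simp only [State.after, State.tick, State.write, run, Store.set, cost, add_assoc]
  | seq c d hc hd =>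
    rw [toProg]
    convert Exec.seq (hc hok.1 s) (hd hok.2 _) using 1
    simp only [State.after, run, cost, State.store, add_assoc]
  | guard b c hc =>
    rw [toProg]
    by_cases h : b.val s.mem = 0
    · convert Exec.cond_false h (.skip _) using 1
      rw [run, cost, if_pos h, if_pos h]
      simp only [State.after, State.tick, add_assoc]
    · convert Exec.cond_true h (hc hok _) using 1
      rw [run, cost, if_neg h, if_neg h]
      simp only [State.after, State.tick, add_assoc]
  | forall_lt x c hc =>
    have hloop := exec_loop (O := O) (ω := ω) hok (hc hok.2.1) s (r := s.store) rfl
      (Nat.zero_le (s.mem 0 0)) 3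
    rw [← Finset.range_eq_Ico] at hloop
    exact .seq (.assign ..) hloop

end Cmd

/-- All memory entries have at most `b` bits. -/
def Store.Bits (s : Store) (b : ℕ) : Prop := ∀ a i, (s.mem a i).size ≤ b

theorem Store.Bits.mono {s : Store} {b b' : ℕ} (h : s.Bits b) (hb : b ≤ b') : s.Bits b' :=
  fun a i => (h a i).trans hb

theorem Store.Bits.set {s : Store} {b x : ℕ} (h : s.Bits b) (hx : x.size ≤ b) (a i : ℕ) :
    (s.set a i x).Bits b := by
  intro a' i'
  rw [Store.mem_set]
  split_ifs
  · exact hx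
  · exact h a' i'

theorem size_le_self (x : ℕ) : x.size ≤ x := Nat.size_le.2 Nat.lt_two_pow_self

theorem size_add_le (x y : ℕ) : (x + y).size ≤ max x.size y.size + 1 := by
  rw [Nat.size_le, pow_succ, mul_two]
  exact Nat.add_lt_add (Nat.size_le.1 (le_max_left ..)) (Nat.size_le.1 (le_max_right ..))

theorem size_mul_le (x y : ℕ) : (x * y).size ≤ x.size + y.size := by
  rw [Nat.size_le, pow_add]
  exact Nat.mul_lt_mul'' (Nat.lt_size_self x) (Nat.lt_size_self y)

theorem size_ite_le (p : Prop) [Decidable p] : (if p then 1 else 0 : ℕ).size ≤ 1 := by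
  split_ifs <;> simp

theorem size_eval_le (o : Op) (x y : ℕ) : (o.eval x y).size ≤ x.size + y.size + 1 := by
  cases o with
  | add => exact (size_add_le x y).trans (by omega)
  | sub => exact (Nat.size_le_size (Nat.sub_le x y)).trans (by omega)
  | mul => exact (size_mul_le x y).trans (by omega)
  | div => exact (Nat.size_le_size (Nat.div_le_self x y)).trans (by omega)
  | lt => exact (size_ite_le (x < y)).trans (by omega)
  | eq => exact (size_ite_le (x = y)).trans (by omega)

theorem Expr.exists_cost_le (e : Expr) : ∃ K, ∀ (s : Store) (b : ℕ), s.Bits b →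
    (e.val s.mem).size ≤ K * (b + 1) ∧ e.cost s.mem ≤ K * (b + 1) := by
  induction e with
  | lit l =>
    refine ⟨1 + l.size, fun s b _ => ?_⟩
    have h : 1 + l.size ≤ (1 + l.size) * (b + 1) := Nat.le_mul_of_pos_right _ b.succ_pos
    exact ⟨(Nat.le_add_left ..).trans h, h⟩
  | cell a e ih =>
    obtain ⟨K, hK⟩ := ih
    refine ⟨K + 1, fun s b hb => ?_⟩
    have hval := hb a (e.val s.mem)
    have hcost := (hK s b hb).2
    rw [add_one_mul, Expr.val, Expr.cost]
    constructor <;> omega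
  | bin o e₁ e₂ ih₁ ih₂ =>
    obtain ⟨K₁, h₁⟩ := ih₁
    obtain ⟨K₂, h₂⟩ := ih₂
    refine ⟨2 * K₁ + 2 * K₂ + 2, fun s b hb => ?_⟩
    have hval := size_eval_le o (e₁.val s.mem) (e₂.val s.mem)
    have ⟨hval₁, hcost₁⟩ := h₁ s b hb
    have ⟨hval₂, hcost₂⟩ := h₂ s b hb
    rw [Expr.val, Expr.cost, add_mul, add_mul, mul_assoc, mul_assoc]
    constructor <;> omega

theorem Expr.Additive.exists_size_le {e : Expr} (he : e.Additive) :
    ∃ K, ∀ (s : Store) (b : ℕ), s.Bits b → (e.val s.mem).size ≤ b + K := by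
  induction e with
  | lit l => exact ⟨l.size, fun s b _ => Nat.le_add_left _ _⟩
  | cell a e _ => exact ⟨0, fun s b hb => hb _ _⟩
  | bin o e₁ e₂ ih₁ ih₂ =>
    cases o with
    | mul => exact he.elim
    | lt => exact ⟨1, fun s b _ => (size_ite_le _).trans (Nat.le_add_left ..)⟩
    | eq => exact ⟨1, fun s b _ => (size_ite_le _).trans (Nat.le_add_left ..)⟩
    | add =>
      obtain ⟨K₁, h₁⟩ := ih₁ he.1
      obtain ⟨K₂, h₂⟩ := ih₂ he.2
      refine ⟨max K₁ K₂ + 1, fun s b hb => (size_add_le _ _).trans ?_⟩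
      have := h₁ s b hb
      have := h₂ s b hb
      omega
    | sub =>
      obtain ⟨K₁, h₁⟩ := ih₁ he.1
      exact ⟨K₁, fun s b hb => (Nat.size_le_size (Nat.sub_le _ _)).trans (h₁ s b hb)⟩
    | div =>
      obtain ⟨K₁, h₁⟩ := ih₁ he.1
      exact ⟨K₁, fun s b hb => (Nat.size_le_size (Nat.div_le_self _ _)).trans (h₁ s b hb)⟩

theorem eval_mono (p : Polynomial ℕ) {x y : ℕ} (h : x ≤ y) : p.eval x ≤ p.eval y := by
  simp only [Polynomial.eval_eq_sum]
  exact Finset.sum_le_sum fun i _ => Nat.mul_le_mul_left _ (Nat.pow_le_pow_left h i)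

namespace Cmd

variable {c : Cmd}

theorem bits_loop {x n b G : ℕ} {f : Store → Store} (hx : 0 ≠ x)
    (hf0 : ∀ s, (f s).mem 0 = s.mem 0)
    (hf : ∀ s b, s.mem 0 0 = n → s.Bits b → (f s).Bits (b + G)) {s : Store} (hn : s.mem 0 0 = n)
    (hb : s.Bits b) (i : ℕ) : (s.loop x f i).Bits (b + i * (G + 1)) := by
  induction i with
  | zero => simpa [Store.loop] using hb.set (by simp) x 0
  | succ i ih =>
    refine ((hf _ _ ?_ ih).mono ?_).set ((size_le_self _).trans ?_) x 0
    · rw [mem_loop_of_forall hx hf0, hn]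
    · linarith
    · nlinarith

theorem Ok.exists_bits_run (hok : c.Ok) : ∃ G : Polynomial ℕ, ∀ (O : ℕ → ℕ → Bool) (s : Store)
    (b : ℕ), s.Bits b → (c.run O s).Bits (b + G.eval (s.mem 0 0)) := by
  induction c with
  | assign a i e =>
    obtain ⟨K, hK⟩ := hok.2.exists_size_le
    refine ⟨.C K, fun O s b hb => ?_⟩
    rw [Polynomial.eval_C]
    exact (hb.mono (Nat.le_add_right ..)).set (hK s b hb) _ _
  | query a i u v =>
    refine ⟨1, fun O s b hb => ?_⟩
    rw [Polynomial.eval_one]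
    refine Store.Bits.set (hb.mono (Nat.le_add_right ..)) ?_ _ _
    exact (size_le_self _).trans ((Bool.toNat_le _).trans (Nat.le_add_left ..))
  | seq c d hc hd =>
    obtain ⟨G₁, h₁⟩ := hc hok.1
    obtain ⟨G₂, h₂⟩ := hd hok.2
    refine ⟨G₁ + G₂, fun O s b hb => ?_⟩
    have h := h₂ O _ _ (h₁ O s b hb)
    rwa [hok.1.mem_run_zero, add_assoc, ← Polynomial.eval_add] at h
  | guard e c hc =>
    obtain ⟨G, h⟩ := hc hok
    refine ⟨G, fun O s b hb => ?_⟩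
    rw [run]
    split_ifs
    · exact hb.mono (Nat.le_add_right ..)
    · exact h O s b hb
  | forall_lt x c hc =>
    obtain ⟨G, h⟩ := hc hok.2.1
    refine ⟨.X * (G + 1), fun O s b hb => ?_⟩
    rw [Polynomial.eval_mul, Polynomial.eval_add, Polynomial.eval_X, Polynomial.eval_one]
    refine bits_loop hok.1.symm hok.2.1.mem_run_zero (fun r b hr hb => ?_) rfl hb _
    exact hr ▸ h O r b hb

open Polynomial

theorem exists_cost_seq_le {d : Cmd} (hok : (seq c d).Ok) {T₁ T₂ : ℕ[X]}
    (h₁ : ∀ (O : ℕ → ℕ → Bool) (s : Store) (b : ℕ), s.Bits b →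
      c.cost O s ≤ T₁.eval (s.mem 0 0 + b))
    (h₂ : ∀ (O : ℕ → ℕ → Bool) (s : Store) (b : ℕ), s.Bits b →
      d.cost O s ≤ T₂.eval (s.mem 0 0 + b)) :
    ∃ T : ℕ[X], ∀ (O : ℕ → ℕ → Bool) (s : Store) (b : ℕ), s.Bits b →
      (seq c d).cost O s ≤ T.eval (s.mem 0 0 + b) := by
  obtain ⟨G, hG⟩ := hok.1.exists_bits_run
  refine ⟨T₁ + T₂.comp (X + G), fun O s b hb => ?_⟩
  have h := h₂ O _ _ (hG O s b hb)
  rw [hok.1.mem_run_zero] at h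
  rw [cost, eval_add, eval_comp, eval_add, eval_X, add_assoc (s.mem 0 0)]
  refine Nat.add_le_add (h₁ O s b hb) (h.trans (eval_mono T₂ ?_))
  have := eval_mono G (Nat.le_add_right (s.mem 0 0) b)
  omega

theorem exists_cost_forall_lt_le {x : ℕ} (hok : (forall_lt x c).Ok) {G T : ℕ[X]}
    (hG : ∀ (O : ℕ → ℕ → Bool) (s : Store) (b : ℕ), s.Bits b →
      (c.run O s).Bits (b + G.eval (s.mem 0 0)))
    (hT : ∀ (O : ℕ → ℕ → Bool) (s : Store) (b : ℕ), s.Bits b →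
      c.cost O s ≤ T.eval (s.mem 0 0 + b)) :
    ∃ T' : ℕ[X], ∀ (O : ℕ → ℕ → Bool) (s : Store) (b : ℕ), s.Bits b →
      (forall_lt x c).cost O s ≤ T'.eval (s.mem 0 0 + b) := by
  obtain ⟨K₁, hK₁⟩ := (loopTest x).exists_cost_le
  obtain ⟨K₂, hK₂⟩ := (loopNext x).exists_cost_le
  let B : ℕ[X] := X + X * (G + 1)
  let P : ℕ[X] := 3 + T.comp (X + B) + C (K₁ + K₂) * (B + G + 1)
  refine ⟨3 + X * P + (1 + C K₁ * (B + 1)), fun O s b hb => ?_⟩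
  have hG_le := eval_mono G (Nat.le_add_right (s.mem 0 0) b)
  have h0 (i) : (s.loop x (c.run O) i).mem 0 0 = s.mem 0 0 := by
    rw [mem_loop_of_forall hok.1.symm hok.2.1.mem_run_zero]
  have hbits : ∀ i ≤ s.mem 0 0, (s.loop x (c.run O) i).Bits (B.eval (s.mem 0 0 + b)) := by
    refine fun i hi => (bits_loop hok.1.symm hok.2.1.mem_run_zero
      (fun r b hr hb => hr ▸ hG O r b hb) rfl hb i).mono ?_
    simp only [B, eval_add, eval_mul, eval_X, eval_one]
    exact Nat.add_le_add (Nat.le_add_left ..) (Nat.mul_le_mul (by omega) (by omega))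
  have hpass : ∀ i < s.mem 0 0, passCost x (c.run O) (c.cost O) (s.loop x (c.run O) i) ≤
      P.eval (s.mem 0 0 + b) := by
    intro i hi
    have hbi := hbits i hi.le
    have htest := (hK₁ _ _ hbi).2
    have hnext := (hK₂ _ _ (hG O _ _ hbi)).2
    have hbody := hT O _ _ hbi
    rw [h0] at hbody hnext
    have hT_le := eval_mono T (Nat.add_le_add_right (Nat.le_add_right (s.mem 0 0) b)
      (B.eval (s.mem 0 0 + b)))
    simp only [P, passCost, eval_add, eval_mul, eval_C, eval_comp, eval_X, eval_one, eval_ofNat]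
    nlinarith
  have hsum := Finset.sum_le_card_nsmul _ _ _ fun i hi => hpass i (Finset.mem_range.1 hi)
  have hlast := (hK₁ _ _ (hbits _ le_rfl)).2
  rw [Finset.card_range, smul_eq_mul] at hsum
  simp only [cost, eval_add, eval_mul, eval_C, eval_X, eval_one, eval_ofNat]
  nlinarith

theorem Ok.exists_cost_le (hok : c.Ok) : ∃ T : ℕ[X], ∀ (O : ℕ → ℕ → Bool) (s : Store)
    (b : ℕ), s.Bits b → c.cost O s ≤ T.eval (s.mem 0 0 + b) := by
  induction c with
  | assign a i e =>
    obtain ⟨K₁, hK₁⟩ := i.exists_cost_le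
    obtain ⟨K₂, hK₂⟩ := e.exists_cost_le
    refine ⟨1 + C (K₁ + K₂) * (X + 1), fun O s b hb => ?_⟩
    have h₁ := (hK₁ s b hb).2
    have h₂ := (hK₂ s b hb).2
    simp only [cost, eval_mul, eval_C, eval_add, eval_X, eval_one]
    nlinarith [Nat.zero_le ((K₁ + K₂) * s.mem 0 0)]
  | query a i u v =>
    obtain ⟨K₁, hK₁⟩ := i.exists_cost_le
    obtain ⟨K₂, hK₂⟩ := u.exists_cost_le
    obtain ⟨K₃, hK₃⟩ := v.exists_cost_le
    refine ⟨1 + C (K₁ + K₂ + K₃) * (X + 1), fun O s b hb => ?_⟩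
    have h₁ := (hK₁ s b hb).2
    have h₂ := (hK₂ s b hb).2
    have h₃ := (hK₃ s b hb).2
    simp only [cost, eval_mul, eval_C, eval_add, eval_X, eval_one]
    nlinarith [Nat.zero_le ((K₁ + K₂ + K₃) * s.mem 0 0)]
  | seq c d hc hd =>
    obtain ⟨T₁, h₁⟩ := hc hok.1
    obtain ⟨T₂, h₂⟩ := hd hok.2
    exact exists_cost_seq_le hok h₁ h₂
  | guard e c hc =>
    obtain ⟨T, h⟩ := hc hok
    obtain ⟨K, hK⟩ := e.exists_cost_le
    refine ⟨T + 2 + C K * (X + 1), fun O s b hb => ?_⟩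
    have hcost := h O s b hb
    have hguard := (hK s b hb).2
    simp only [cost, eval_mul, eval_C, eval_add, eval_X, eval_one, eval_ofNat]
    split_ifs <;> nlinarith [Nat.zero_le (K * s.mem 0 0)]
  | forall_lt x c hc =>
    obtain ⟨T, hT⟩ := hc hok.2.1
    obtain ⟨G, hG⟩ := hok.2.1.exists_bits_run
    exact exists_cost_forall_lt_le hok hG hT

theorem bits_initState {n q : ℕ} (W : Pair n → Fin q) : (initState W).store.Bits (n + q) := by
  refine fun a i => (size_le_self _).trans ?_
  simp only [initState, sideArray]
  split_ifs
  · exact Nat.le_add_right ..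
  · exact Nat.zero_le _
  · exact (Fin.is_lt _).le.trans (Nat.le_add_left ..)
  · exact Nat.zero_le _
  · exact Nat.zero_le _

/-- The store in which the program of the command `cmd` halts. -/
def final (cmd : Cmd) {n k q : ℕ} (c : Fin n → Fin k) (W : Pair n → Fin q) : Store :=
  cmd.run (oracle c) (initState W).store

theorem haltsIn_after (hok : c.Ok) {n k q : ℕ} (f : Fin n → Fin k) (W : Pair n → Fin q)
    (ω : ℕ → Bool) : HaltsIn c.toProg f W ω
      ((initState W).after (c.final f W) (c.cost (oracle f) (initState W).store)) :=
  exec_toProg hok _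

theorem polyTime_toProg (hok : c.Ok) (q : ℕ) : PolyTime q c.toProg := by
  obtain ⟨T, hT⟩ := hok.exists_cost_le
  refine ⟨T.comp (2 * .X + .C q), fun n k f W ω => ⟨_, haltsIn_after hok f W ω, ?_⟩⟩
  refine (Nat.zero_add _).trans_le ((hT _ _ _ (bits_initState W)).trans_eq ?_)
  have : n + (n + q) = 2 * n + q := by ring
  simp [initState, Polynomial.eval_comp, this]

end Cmd

/-! ### The clustering algorithm -/

/-- A partial clustering and the number of queries spent on it. The label `0` stands for an
element that is not yet classified, the label `r + 1` for an element of the cluster of `r`. -/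
@[ext] structure Progress where
  labels : ℕ → ℕ
  queries : ℕ

/-- Position of the entry of the similarity matrix for the elements `v` and `a`. -/
def pos (n v a : ℕ) : ℕ := (v - (v - a)) * n + (v + (a - v))

/-- Two counts differ by more than random fluctuations: up to a constant factor, `Far τ a b` means
that the distance of `√a` and `√b` exceeds `√τ`. -/
def Far (τ a b : ℕ) : Prop := τ * (a + b) < (a - b + (b - a)) * (a - b + (b - a))

instance (τ a b : ℕ) : Decidable (Far τ a b) := Nat.decLt _ _

/-- The elements with a given label are represented by the element that the label refers to. -/
def IsRep (f : ℕ → ℕ) (r : ℕ) : Prop := f r = r + 1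

instance (f : ℕ → ℕ) : DecidablePred (IsRep f) := fun r => Nat.decEq (f r) (r + 1)

/-- The number of queries that compare an element with all representatives. -/
def repCount (n : ℕ) (f : ℕ → ℕ) : ℕ := Nat.count (IsRep f) n

/-- The label of the cluster of `u` among the clusters found so far, `0` if there is none. -/
def findLabel (n : ℕ) (O : ℕ → ℕ → Bool) (f : ℕ → ℕ) (u : ℕ) : ℕ :=
  Nat.findGreatest (fun l => IsRep f (l - 1) ∧ O u (l - 1) = true) n

/-- Compare `u` with all representatives. -/
def classify (n : ℕ) (O : ℕ → ℕ → Bool) (u : ℕ) (p : Progress) : Progress where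
  labels := Function.update p.labels u
    (if findLabel n O p.labels u = 0 then u + 1 else findLabel n O p.labels u)
  queries := p.queries + repCount n p.labels

/-- The number of occurrences of the symbol `x` as similarity of `v` to the elements of the cluster
of `u` that are processed up to `u`. The representative is left out, so that it can be compared
with the other elements. -/
def symbolCount (n : ℕ) (W f : ℕ → ℕ) (u x v : ℕ) : ℕ :=
  Nat.count (fun a => a < u + 1 ∧ f a = f u ∧ a + 1 ≠ f u ∧ W (pos n v a) = x) n

/-- The symbol `x` clearly distinguishes some element outside the cluster of `u` from the
representative of the cluster. -/
def Ready (n : ℕ) (W f : ℕ → ℕ) (u x : ℕ) : Prop :=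
  ∃ v < n, f v ≠ f u ∧
    Far (500 * n.size) (symbolCount n W f u x v) (symbolCount n W f u x (f u - 1))

/-- On the basis of the symbol `x`, the element `v` is assumed to belong to the cluster of `u`. -/
def IsCandidate (n : ℕ) (W f : ℕ → ℕ) (u x v : ℕ) : Prop :=
  Ready n W f u x ∧ f v = 0 ∧
    ¬ Far (40 * n.size) (symbolCount n W f u x v) (symbolCount n W f u x (f u - 1))

instance (n : ℕ) (W f : ℕ → ℕ) (u x : ℕ) : Decidable (Ready n W f u x) :=
  inferInstanceAs (Decidable (∃ v < n, f v ≠ f u ∧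
    Far (500 * n.size) (symbolCount n W f u x v) (symbolCount n W f u x (f u - 1))))

instance (n : ℕ) (W f : ℕ → ℕ) (u x : ℕ) : DecidablePred (IsCandidate n W f u x) :=
  fun _ => instDecidableAnd

/-- The candidates for the symbol `x` join the cluster of `u`; if `conf` is set, only those that
the oracle confirms. -/
def absorb (n : ℕ) (W : ℕ → ℕ) (O : ℕ → ℕ → Bool) (conf : Bool) (u x : ℕ) (p : Progress) :
    Progress where
  labels v :=
    if v < n ∧ IsCandidate n W p.labels u x v ∧ (conf = true → O v (p.labels u - 1) = true)
    then p.labels u else p.labels v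
  queries := p.queries + if conf then Nat.count (IsCandidate n W p.labels u x) n else 0

/-- Absorption for the first symbols in turn. -/
def absorbs (n : ℕ) (W : ℕ → ℕ) (O : ℕ → ℕ → Bool) (conf : Bool) (u : ℕ) (p : Progress) :
    ℕ → Progress
  | 0 => p
  | x + 1 => absorb n W O conf u x (absorbs n W O conf u p x)

/-- Processing of the element `u`. Trying the numbers below `n` as symbols covers the alphabet as
soon as `n` is at least its size. -/
def stage (n : ℕ) (W : ℕ → ℕ) (O : ℕ → ℕ → Bool) (conf : Bool) (u : ℕ) (p : Progress) : Progress :=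
  if p.labels u = 0 then absorbs n W O conf u (classify n O u p) n else p

/-- The result of processing the first elements in turn. -/
def stages (n : ℕ) (W : ℕ → ℕ) (O : ℕ → ℕ → Bool) (conf : Bool) : ℕ → Progress
  | 0 => ⟨fun _ => 0, 0⟩
  | u + 1 => stage n W O conf u (stages n W O conf u)

/-! ### The clustering program -/

namespace Arr

-- `size`, `similarity` and `labels` are the arrays that the model uses for input and output. Of the
-- others, `counts` is indexed by elements, and the rest serve as variables, stored in entry `0`.

@[simp] abbrev size : ℕ := 0
@[simp] abbrev similarity : ℕ := 1
@[simp] abbrev labels : ℕ := 2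
@[simp] abbrev element : ℕ := 3
@[simp] abbrev rep : ℕ := 4
@[simp] abbrev answer : ℕ := 5
@[simp] abbrev symbol : ℕ := 6
@[simp] abbrev other : ℕ := 7
@[simp] abbrev member : ℕ := 8
@[simp] abbrev counts : ℕ := 9
@[simp] abbrev ready : ℕ := 10
@[simp] abbrev bits : ℕ := 11
@[simp] abbrev power : ℕ := 12
@[simp] abbrev scan : ℕ := 13
@[simp] abbrev found : ℕ := 14

end Arr

namespace Expr

instance (m : ℕ) : OfNat Expr m := ⟨.lit m⟩
instance : Add Expr := ⟨.bin .add⟩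
instance : Sub Expr := ⟨.bin .sub⟩
instance : Mul Expr := ⟨.bin .mul⟩

/-- Equality test. -/
def eq (e f : Expr) : Expr := .bin .eq e f

/-- Comparison. -/
def lt (e f : Expr) : Expr := .bin .lt e f

/-- Conjunction of tests. -/
def and (e f : Expr) : Expr := e * f

/-- Negation of a test. -/
def not (e : Expr) : Expr := e.eq 0

/-- The test `e` succeeds. -/
def Holds (m : ℕ → ℕ → ℕ) (e : Expr) : Prop := e.val m ≠ 0

instance (m : ℕ → ℕ → ℕ) (e : Expr) : Decidable (e.Holds m) := instDecidableNot

section Simp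

variable (m : ℕ → ℕ → ℕ) (e f : Expr)

@[simp] theorem val_lit (l : ℕ) : (lit l).val m = l := rfl
@[simp] theorem val_zero : (0 : Expr).val m = 0 := rfl
@[simp] theorem val_one : (1 : Expr).val m = 1 := rfl
@[simp] theorem val_add : (e + f).val m = e.val m + f.val m := rfl
@[simp] theorem val_sub : (e - f).val m = e.val m - f.val m := rfl
@[simp] theorem val_mul : (e * f).val m = e.val m * f.val m := rfl
@[simp] theorem val_cell (a : ℕ) : (cell a e).val m = m a (e.val m) := rfl

@[simp] theorem holds_cell (a : ℕ) : (cell a e).Holds m ↔ m a (e.val m) ≠ 0 := Iff.rfl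

@[simp] theorem holds_eq : (e.eq f).Holds m ↔ e.val m = f.val m := by
  simp [eq, Holds, val, Op.eval]

@[simp] theorem holds_lt : (e.lt f).Holds m ↔ e.val m < f.val m := by
  simp [lt, Holds, val, Op.eval]

@[simp] theorem holds_and : (e.and f).Holds m ↔ e.Holds m ∧ f.Holds m := by
  simp [and, Holds]

@[simp] theorem holds_not : e.not.Holds m ↔ ¬ e.Holds m := by
  rw [not, holds_eq, Holds, not_not, val_zero]

@[simp] theorem additive_zero : (0 : Expr).Additive := trivial
@[simp] theorem additive_one : (1 : Expr).Additive := trivial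
@[simp] theorem additive_cell (a : ℕ) : (cell a e).Additive := trivial
@[simp] theorem additive_add : (e + f).Additive ↔ e.Additive ∧ f.Additive := Iff.rfl

end Simp

/-- Test for `Far (τ * L)`, where `L` is the bit length of the input size. -/
def far (τ : ℕ) (e f : Expr) : Expr :=
  (lit τ * reg Arr.bits * (e + f)).lt ((e - f + (f - e)) * (e - f + (f - e)))

@[simp] theorem holds_far (m : ℕ → ℕ → ℕ) (τ : ℕ) (e f : Expr) :
    (far τ e f).Holds m ↔ Far (τ * m Arr.bits 0) (e.val m) (f.val m) := by
  rw [far, holds_lt]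
  rfl

/-- The entry of the similarity matrix for the elements `v` and `a`. -/
def similarity (v a : Expr) : Expr :=
  cell Arr.similarity ((v - (v - a)) * reg Arr.size + (v + (a - v)))

@[simp] theorem val_similarity (m : ℕ → ℕ → ℕ) (v a : Expr) :
    (similarity v a).val m = m Arr.similarity (pos (m Arr.size 0) (v.val m) (a.val m)) := rfl

/-- The label of the current element. -/
def curLabel : Expr := .cell Arr.labels (reg Arr.element)

@[simp] theorem val_curLabel (m : ℕ → ℕ → ℕ) :
    curLabel.val m = m Arr.labels (m Arr.element 0) := rfl

/-- The representative of the cluster of the current element. -/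
def curRep : Expr := curLabel - 1

@[simp] theorem val_curRep (m : ℕ → ℕ → ℕ) :
    curRep.val m = m Arr.labels (m Arr.element 0) - 1 := rfl

end Expr

namespace Cmd

open Arr

/-- Compute the bit length of the input size. -/
def bitLengthCmd : Cmd :=
  .seq (.assign power 0 1)
    (.forall_lt scan (.guard (.lt (reg power) (reg size + 1))
      (.seq (.assign power 0 (reg power + reg power)) (.assign bits 0 (reg bits + 1)))))

/-- Compute `findLabel` for the current element. -/
def searchCmd : Cmd :=
  .seq (.assign found 0 0)
    (.forall_lt rep (.guard (.eq (.cell labels (reg rep)) (reg rep + 1))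
      (.seq (.query answer 0 (reg element) (reg rep))
        (.guard (reg answer) (.assign found 0 (reg rep + 1))))))

/-- Implementation of `classify`. -/
def classifyCmd : Cmd :=
  .seq searchCmd
    (.seq (.assign labels (reg element) (reg found))
      (.guard (.not (reg found)) (.assign labels (reg element) (reg element + 1))))

/-- Test whether the loop variable contributes to `symbolCount`. -/
def memberTest : Expr :=
  .and (.lt (reg member) (reg element + 1))
    (.and (.eq (.cell labels (reg member)) .curLabel)
      (.and (.not (.eq (reg member + 1) .curLabel))
        (.eq (.similarity (reg other) (reg member)) (reg symbol))))

/-- Compute `symbolCount` for one element. -/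
def tallyCmd : Cmd :=
  .seq (.assign counts (reg other) 0)
    (.forall_lt member (.guard memberTest
      (.assign counts (reg other) (Expr.cell counts (reg other) + 1))))

/-- Compute `symbolCount` for all elements. -/
def countCmd : Cmd := .forall_lt other tallyCmd

/-- The test `Far (τ * L)` for an element and the representative of the current cluster. -/
def farTest (τ : ℕ) : Expr := .far τ (.cell counts (reg other)) (.cell counts .curRep)

/-- Decide `Ready`. -/
def readyCmd : Cmd :=
  .seq (.assign ready 0 0)
    (.forall_lt other
      (.guard (.and (.not (.eq (.cell labels (reg other)) .curLabel)) (farTest 500))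
        (.assign ready 0 1)))

/-- Ask the oracle about a candidate, or trust the test. -/
def confirmCmd : Bool → Cmd
  | true => .query answer 0 (reg other) .curRep
  | false => .assign answer 0 1

/-- The test for the candidates, given the counts and the result of `readyCmd`. -/
def candidateTest : Expr :=
  .and (reg ready) (.and (.not (.cell labels (reg other))) (.not (farTest 40)))

/-- Absorption of one element. -/
def absorbOneCmd (conf : Bool) : Cmd :=
  .guard candidateTest
    (.seq (confirmCmd conf) (.guard (reg answer) (.assign labels (reg other) .curLabel)))

/-- Absorption of all candidates. -/
def absorbCmd (conf : Bool) : Cmd := .forall_lt other (absorbOneCmd conf)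

/-- Implementation of `absorb`. -/
def symbolCmd (conf : Bool) : Cmd := .seq countCmd (.seq readyCmd (absorbCmd conf))

/-- Implementation of `stage`. -/
def stageCmd (conf : Bool) : Cmd :=
  .guard (.not .curLabel) (.seq classifyCmd (.forall_lt symbol (symbolCmd conf)))

/-- The clustering program; if `conf` is set, it confirms all its conclusions by queries. -/
def mainCmd (conf : Bool) : Cmd := .seq bitLengthCmd (.forall_lt element (stageCmd conf))

theorem ok_mainCmd (conf : Bool) : (mainCmd conf).Ok := by
  cases conf <;>
  simp [mainCmd, bitLengthCmd, stageCmd, classifyCmd, searchCmd, symbolCmd, countCmd, tallyCmd,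
    readyCmd, absorbCmd, absorbOneCmd, confirmCmd, Expr.curLabel, Ok, Writes]

/-! ### Effect of the clustering program -/

open Arr

variable {O : ℕ → ℕ → Bool} {s : Store}

@[simp] theorem run_seq (c d : Cmd) : (seq c d).run O s = d.run O (c.run O s) := rfl

@[simp] theorem run_assign (a : ℕ) (i e : Expr) :
    (assign a i e).run O s = s.set a (i.val s.mem) (e.val s.mem) := rfl

@[simp] theorem mem_run_query (a : ℕ) (i u v : Expr) : ((query a i u v).run O s).mem =
    (s.set a (i.val s.mem) (O (u.val s.mem) (v.val s.mem)).toNat).mem := rfl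

@[simp] theorem queries_run_query (a : ℕ) (i u v : Expr) :
    ((query a i u v).run O s).queries = s.queries + 1 := rfl

theorem run_guard_pos {b : Expr} (h : b.Holds s.mem) (c : Cmd) :
    (guard b c).run O s = c.run O s := if_neg h

theorem run_guard_neg {b : Expr} (h : ¬ b.Holds s.mem) (c : Cmd) : (guard b c).run O s = s :=
  if_pos (not_not.1 h)

theorem run_bitLengthCmd (h : s.mem bits 0 = 0) :
    (bitLengthCmd.run O s).mem bits 0 = (s.mem size 0).size ∧
      (bitLengthCmd.run O s).queries = s.queries := by
  set n := s.mem size 0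
  have hloop := run_forall_lt_of_invariant (O := O) (s := s.set power 0 1) (n := n) (x := scan)
    (c := .guard (.lt (reg power) (reg size + 1))
      (.seq (.assign power 0 (reg power + reg power)) (.assign bits 0 (reg bits + 1))))
    (by simp [n])
    (fun i t => t.mem bits 0 = min i n.size ∧ t.mem power 0 = 2 ^ min i n.size ∧
      t.queries = s.queries) (fun i t y => by simp) (by simp [h]) ?_
  · exact ⟨hloop.1.trans (min_eq_right (size_le_self n)), hloop.2.2⟩
  rintro i - t - ht ⟨hbits, hpower, hq⟩
  have hsize : t.mem size 0 = n := by rw [ht size (by simp [Writes])]; simp [n]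
  have htest : (Expr.lt (reg power) (reg size + 1)).Holds t.mem ↔ i < n.size := by
    simp [-Arr.power, -Arr.size, hsize, hpower, ← Nat.lt_size]
  by_cases hi : i < n.size
  · rw [run_guard_pos (htest.2 hi)]
    rw [min_eq_left hi.le] at hbits hpower
    simp [min_eq_left (Nat.succ_le_of_lt hi), hbits, hpower, hq, pow_succ, mul_two]
  · rw [run_guard_neg (mt htest.1 hi), min_eq_right (by omega)]
    rw [min_eq_right (by omega)] at hbits hpower
    exact ⟨hbits, hpower, hq⟩

theorem run_searchCmd :
    (searchCmd.run O s).mem found 0 =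
        findLabel (s.mem size 0) O (s.mem labels) (s.mem element 0) ∧
      (searchCmd.run O s).queries = s.queries + repCount (s.mem size 0) (s.mem labels) := by
  rw [searchCmd, run_seq, run_assign]
  refine run_forall_lt_of_invariant (n := s.mem size 0) (by simp)
    (fun i t => t.mem found 0 = findLabel i O (s.mem labels) (s.mem element 0) ∧
      t.queries = s.queries + repCount i (s.mem labels))
    (fun i t y => by simp) (by simp [findLabel, repCount]) ?_
  rintro i - t hi ht ⟨hfound, hq⟩
  have hlabels : t.mem labels = s.mem labels := by rw [ht _ (by simp [Writes])]; simp
  have helement : t.mem element = s.mem element := by rw [ht _ (by simp [Writes])]; simp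
  have htest : (Expr.eq (.cell labels (reg rep)) (reg rep + 1)).Holds t.mem ↔
      IsRep (s.mem labels) i := by
    simp [-Arr.labels, hlabels, hi, IsRep]
  rw [findLabel, Nat.findGreatest_succ, repCount, Nat.count_succ, ← findLabel, ← repCount]
  by_cases hr : IsRep (s.mem labels) i
  · rw [run_guard_pos (htest.2 hr), run_seq]
    cases ho : O (s.mem element 0) i
    · rw [run_guard_neg]
      all_goals simp_all [add_assoc]
    · rw [run_guard_pos]
      all_goals simp_all [add_assoc]
  · rw [run_guard_neg (mt htest.1 hr)]
    simp_all

theorem run_tallyCmd :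
    (tallyCmd.run O s).mem counts = Function.update (s.mem counts) (s.mem other 0)
        (symbolCount (s.mem size 0) (s.mem similarity) (s.mem labels) (s.mem element 0)
          (s.mem symbol 0) (s.mem other 0)) ∧
      (tallyCmd.run O s).queries = s.queries := by
  rw [tallyCmd, run_seq, run_assign]
  refine run_forall_lt_of_invariant (n := s.mem size 0) (by simp)
    (fun i t => t.mem counts =
      Function.update (s.mem counts) (s.mem other 0) (Nat.count _ i) ∧ t.queries = s.queries)
    (fun i t y => by simp) (by simp) ?_
  rintro i - t hi ht ⟨hcounts, hq⟩
  have hframe (a) (ha : a ≠ counts ∧ a ≠ member) : t.mem a = s.mem a := by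
    rw [ht a (by simp [Writes, ha]), Store.mem_set_of_ne _ ha.1]
  have htest : memberTest.Holds t.mem ↔ i < s.mem element 0 + 1 ∧
      s.mem labels i = s.mem labels (s.mem element 0) ∧
      i + 1 ≠ s.mem labels (s.mem element 0) ∧
      s.mem similarity (pos (s.mem size 0) (s.mem other 0) i) = s.mem symbol 0 := by
    have hi' : t.mem member 0 = i := hi
    simp [-member, -element, -labels, -size, -similarity, -other, -symbol, memberTest, hframe, hi']
  rw [Nat.count_succ]
  split_ifs with h
  · rw [run_guard_pos (htest.2 h)]
    simp_all
  · rw [run_guard_neg (mt htest.1 h)]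
    exact ⟨hcounts, hq⟩

theorem run_countCmd :
    (∀ v < s.mem size 0, (countCmd.run O s).mem counts v =
        symbolCount (s.mem size 0) (s.mem similarity) (s.mem labels) (s.mem element 0)
          (s.mem symbol 0) v) ∧
      (countCmd.run O s).queries = s.queries := by
  refine run_forall_lt_of_invariant (n := s.mem size 0) rfl
    (fun i t => (∀ v < i, t.mem counts v = symbolCount (s.mem size 0) (s.mem similarity)
      (s.mem labels) (s.mem element 0) (s.mem symbol 0) v) ∧ t.queries = s.queries)
    (fun i t y => by simp) (by simp) ?_
  rintro i - t hi ht ⟨hcounts, hq⟩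
  obtain ⟨hcounts', hq'⟩ := run_tallyCmd (O := O) (s := t)
  rw [hi, ht size (by simp [Writes, tallyCmd]), ht similarity (by simp [Writes, tallyCmd]),
    ht labels (by simp [Writes, tallyCmd]), ht element (by simp [Writes, tallyCmd]),
    ht symbol (by simp [Writes, tallyCmd])] at hcounts'
  refine ⟨fun v hv => ?_, hq'.trans hq⟩
  rw [hcounts']
  rcases (Nat.lt_succ_iff_lt_or_eq.1 hv) with hv | rfl
  · rw [Function.update_of_ne hv.ne, hcounts v hv]
  · rw [Function.update_self]

theorem holds_farTest (m : ℕ → ℕ → ℕ) (τ : ℕ) :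
    (farTest τ).Holds m ↔ Far (τ * m bits 0) (m counts (m other 0))
      (m counts (m labels (m element 0) - 1)) := by
  rw [farTest, Expr.holds_far]
  rfl

theorem run_readyCmd :
    ((readyCmd.run O s).mem ready 0 ≠ 0 ↔
        ∃ v < s.mem size 0, s.mem labels v ≠ s.mem labels (s.mem element 0) ∧
          Far (500 * s.mem bits 0) (s.mem counts v)
            (s.mem counts (s.mem labels (s.mem element 0) - 1))) ∧
      (readyCmd.run O s).queries = s.queries := by
  rw [readyCmd, run_seq, run_assign]
  refine run_forall_lt_of_invariant (n := s.mem size 0) (by simp)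
    (fun i t => (t.mem ready 0 ≠ 0 ↔ ∃ v < i, s.mem labels v ≠ s.mem labels (s.mem element 0) ∧
          Far (500 * s.mem bits 0) (s.mem counts v)
            (s.mem counts (s.mem labels (s.mem element 0) - 1))) ∧ t.queries = s.queries)
    (fun i t y => by simp) (by simp) ?_
  rintro i - t hi ht ⟨hready, hq⟩
  have hframe (a) (ha : a ≠ other ∧ a ≠ ready) : t.mem a = s.mem a := by
    rw [ht a (by simp [Writes, ha]), Store.mem_set_of_ne _ ha.2]
  have htest : (Expr.and (.not (.eq (.cell labels (reg other)) .curLabel)) (farTest 500)).Holds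
      t.mem ↔ s.mem labels i ≠ s.mem labels (s.mem element 0) ∧
        Far (500 * s.mem bits 0) (s.mem counts i)
          (s.mem counts (s.mem labels (s.mem element 0) - 1)) := by
    have hi' : t.mem other 0 = i := hi
    simp [-other, -element, -labels, -bits, -counts, holds_farTest, hframe, hi']
  rw [Nat.exists_lt_succ_right]
  by_cases h : (Expr.and (.not (.eq (.cell labels (reg other)) .curLabel)) (farTest 500)).Holds
      t.mem
  · rw [run_guard_pos h]
    simp [htest.1 h, hq]
  · rw [run_guard_neg h, hready, or_iff_left (mt htest.2 h)]
    exact ⟨Iff.rfl, hq⟩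

theorem run_confirmCmd (conf : Bool) :
    (((confirmCmd conf).run O s).mem answer 0 ≠ 0 ↔ (conf = true →
        O (s.mem other 0) (s.mem labels (s.mem element 0) - 1) = true)) ∧
      ((confirmCmd conf).run O s).queries = s.queries + if conf then 1 else 0 := by
  cases conf <;> simp [confirmCmd]

theorem absorbOneCmd_not_writes (conf : Bool) {a : ℕ} (ha : a ≠ labels ∧ a ≠ answer) :
    ¬ (absorbOneCmd conf).Writes a := by
  cases conf <;> simp [absorbOneCmd, confirmCmd, Writes, ha]

theorem run_absorbOneCmd (conf : Bool) {C : Prop} [Decidable C]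
    (hC : candidateTest.Holds s.mem ↔ C) :
    ((absorbOneCmd conf).run O s).mem labels =
        (if C ∧ (conf = true →
            O (s.mem other 0) (s.mem labels (s.mem element 0) - 1) = true) then
          Function.update (s.mem labels) (s.mem other 0) (s.mem labels (s.mem element 0))
        else s.mem labels) ∧
      ((absorbOneCmd conf).run O s).queries = s.queries + if conf ∧ C then 1 else 0 := by
  by_cases h : C
  · rw [absorbOneCmd, run_guard_pos (hC.2 h), run_seq]
    obtain ⟨hanswer, hq⟩ := run_confirmCmd (O := O) (s := s) conf
    have hframe (a) (ha : a ≠ answer) : ((confirmCmd conf).run O s).mem a = s.mem a :=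
      mem_run_of_not_writes (by cases conf <;> simp [Writes, confirmCmd, ha]) s
    by_cases ha : ((confirmCmd conf).run O s).mem answer 0 ≠ 0
    · rw [run_guard_pos (b := reg answer) ha, if_pos ⟨h, hanswer.1 ha⟩]
      simp [-other, -element, -labels, hframe, hq, h]
    · rw [run_guard_neg (b := reg answer) ha, if_neg fun h => ha (hanswer.2 h.2)]
      simp [-labels, hframe, hq, h]
  · rw [absorbOneCmd, run_guard_neg (mt hC.1 h)]
    simp [h]

theorem run_absorbCmd (conf : Bool) {C : ℕ → Prop} [DecidablePred C] {f : ℕ → ℕ} {u : ℕ}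
    (hf : s.mem labels = f) (hu : s.mem element 0 = u)
    (hC : ∀ v < s.mem size 0, C v ↔ s.mem ready 0 ≠ 0 ∧ f v = 0 ∧
      ¬ Far (40 * s.mem bits 0) (s.mem counts v) (s.mem counts (f u - 1))) :
    (∀ v, ((absorbCmd conf).run O s).mem labels v =
        if v < s.mem size 0 ∧ C v ∧ (conf = true → O v (f u - 1) = true) then f u else f v) ∧
      ((absorbCmd conf).run O s).queries =
        s.queries + if conf then Nat.count C (s.mem size 0) else 0 := by
  refine run_forall_lt_of_invariant (n := s.mem size 0) rfl
    (fun i t => (∀ v, t.mem labels v =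
        if v < i ∧ C v ∧ (conf = true → O v (f u - 1) = true) then f u else f v) ∧
      t.queries = s.queries + if conf then Nat.count C i else 0)
    (fun i t y => by simp) (by simp [hf]) ?_
  rintro i hin t hi ht ⟨hlabels, hq⟩
  have hframe (a) (ha : a ≠ other ∧ a ≠ labels ∧ a ≠ answer) : t.mem a = s.mem a :=
    ht a (not_or.2 ⟨ha.1, absorbOneCmd_not_writes conf ha.2⟩)
  have hu' : t.mem element 0 = u := by rw [hframe _ (by simp), hu]
  have hlu : t.mem labels u = f u := by rw [hlabels, ite_eq_left_iff]; exact fun _ => rfl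
  have htest : candidateTest.Holds t.mem ↔ C i := by
    have hli : t.mem labels i = f i := by rw [hlabels, if_neg fun h => h.1.false]
    have hi' : t.mem other 0 = i := hi
    rw [hC i hin]
    simp [-other, -element, -labels, -bits, -counts, -ready, candidateTest, holds_farTest, hframe,
      hi', hli, hu', hlu]
  obtain ⟨hlabels', hq'⟩ := run_absorbOneCmd (O := O) conf htest
  rw [hi, hu', hlu] at hlabels'
  refine ⟨fun v => ?_, ?_⟩
  · rw [hlabels']
    rcases eq_or_ne v i with rfl | hv
    · have := hlabels v
      split_ifs <;> simp_all
    · rw [apply_ite fun g : ℕ → ℕ => g v, Function.update_of_ne hv, ite_self, hlabels]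
      simp only [show v < i + 1 ↔ v < i by omega]
  · rw [hq', hq, Nat.count_succ]
    cases conf <;> simp [add_assoc]

end Cmd

/-- The store `s` contains the input and the progress `p`. -/
structure Represents (n : ℕ) (W : ℕ → ℕ) (p : Progress) (s : Store) : Prop where
  size_eq : s.mem Arr.size 0 = n
  similarity_eq : s.mem Arr.similarity = W
  bits_eq : s.mem Arr.bits 0 = n.size
  labels_eq : s.mem Arr.labels = p.labels
  queries_eq : s.queries = p.queries
  labels_le : ∀ v, p.labels v ≤ n

namespace Represents

open Arr Cmd

variable {n u x : ℕ} {W : ℕ → ℕ} {O : ℕ → ℕ → Bool} {p : Progress} {s : Store}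

theorem set (h : Represents n W p s) {a : ℕ} (i y : ℕ)
    (ha : a ≠ size ∧ a ≠ similarity ∧ a ≠ bits ∧ a ≠ labels) : Represents n W p (s.set a i y) where
  size_eq := by rw [Store.mem_set_of_ne _ ha.1.symm, h.size_eq]
  similarity_eq := by rw [Store.mem_set_of_ne _ ha.2.1.symm, h.similarity_eq]
  bits_eq := by rw [Store.mem_set_of_ne _ ha.2.2.1.symm, h.bits_eq]
  labels_eq := by rw [Store.mem_set_of_ne _ ha.2.2.2.symm, h.labels_eq]
  queries_eq := h.queries_eq
  labels_le := h.labels_le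

theorem of_run {c : Cmd} (h : Represents n W p s) (hc : ¬ c.Writes size ∧ ¬ c.Writes similarity ∧
    ¬ c.Writes bits) {p' : Progress} (hlabels : (c.run O s).mem labels = p'.labels)
    (hqueries : (c.run O s).queries = p'.queries) (hle : ∀ v, p'.labels v ≤ n) :
    Represents n W p' (c.run O s) where
  size_eq := by rw [mem_run_of_not_writes hc.1, h.size_eq]
  similarity_eq := by rw [mem_run_of_not_writes hc.2.1, h.similarity_eq]
  bits_eq := by rw [mem_run_of_not_writes hc.2.2, h.bits_eq]
  labels_eq := hlabels
  queries_eq := hqueries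
  labels_le := hle

theorem run_classifyCmd (h : Represents n W p s) (hu : s.mem element 0 = u) (hun : u < n) :
    Represents n W (classify n O u p) (classifyCmd.run O s) := by
  obtain ⟨hfound, hq⟩ := run_searchCmd (O := O) (s := s)
  have hframe (a) (ha : a ≠ found ∧ a ≠ rep ∧ a ≠ answer) :
      (searchCmd.run O s).mem a = s.mem a :=
    mem_run_of_not_writes (by simp [Writes, searchCmd, ha]) s
  rw [h.size_eq, h.labels_eq, hu] at hfound
  rw [h.size_eq, h.labels_eq, h.queries_eq] at hq
  refine h.of_run (by simp [Writes, classifyCmd, searchCmd]) ?_ ?_ fun v => ?_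
  · rw [classifyCmd, run_seq, run_seq, classify]
    split_ifs with h0
    · rw [run_guard_pos]
      all_goals simp [-labels, -element, -found, hframe, hfound, hu, h0, h.labels_eq]
    · rw [run_guard_neg]
      all_goals simp [-labels, -element, -found, hframe, hfound, hu, h0, h.labels_eq]
  · rw [classifyCmd, run_seq, run_seq, classify, ← hq]
    by_cases h0 : findLabel n O p.labels u = 0
    · rw [run_guard_pos]
      all_goals simp [-labels, -element, -found, hfound, h0]
    · rw [run_guard_neg]
      all_goals simp [-labels, -element, -found, hfound, h0]
  · rw [classify]
    dsimp only
    rw [Function.update_apply]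
    split_ifs
    exacts [hun, Nat.findGreatest_le n, h.labels_le v]

theorem run_symbolCmd (conf : Bool) (h : Represents n W p s) (hu : s.mem element 0 = u)
    (hx : s.mem symbol 0 = x) (hn : 0 < n) :
    Represents n W (absorb n W O conf u x p) ((symbolCmd conf).run O s) := by
  set s₁ := countCmd.run O s
  set s₂ := readyCmd.run O s₁
  obtain ⟨hcounts, hq₁⟩ := run_countCmd (O := O) (s := s)
  obtain ⟨hready, hq₂⟩ := run_readyCmd (O := O) (s := s₁)
  have hframe₁ (a) (ha : a ≠ counts ∧ a ≠ other ∧ a ≠ member) : s₁.mem a = s.mem a :=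
    mem_run_of_not_writes (by simp [Writes, countCmd, tallyCmd, ha]) s
  have hframe₂ (a) (ha : a ≠ other ∧ a ≠ ready) : s₂.mem a = s₁.mem a :=
    mem_run_of_not_writes (by simp [Writes, readyCmd, ha]) s₁
  have hframe (a) (ha : a ≠ counts ∧ a ≠ other ∧ a ≠ member ∧ a ≠ ready) :
      s₂.mem a = s.mem a := by
    rw [hframe₂ a ⟨ha.2.1, ha.2.2.2⟩, hframe₁ a ⟨ha.1, ha.2.1, ha.2.2.1⟩]
  have hrep : p.labels u - 1 < n := by have := h.labels_le u; omega
  rw [h.size_eq, h.similarity_eq, h.labels_eq, hu, hx] at hcounts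
  rw [hframe₁ size (by simp), hframe₁ labels (by simp), hframe₁ element (by simp),
    hframe₁ bits (by simp), h.size_eq, h.labels_eq, h.bits_eq, hu, hcounts _ hrep] at hready
  have hready' : s₂.mem ready 0 ≠ 0 ↔ Ready n W p.labels u x :=
    hready.trans (exists_congr fun v => and_congr_right fun hv => by rw [hcounts v hv])
  obtain ⟨hlabels, hq⟩ := run_absorbCmd (O := O) (s := s₂) conf
    (C := IsCandidate n W p.labels u x) ((hframe labels (by simp)).trans h.labels_eq)
    ((congrFun (hframe element (by simp)) 0).trans hu) fun v hv => by
      rw [hframe size (by simp), h.size_eq] at hv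
      rw [hready', hframe bits (by simp), h.bits_eq, hframe₂ counts (by simp), hcounts v hv,
        hcounts _ hrep, IsCandidate]
  rw [hframe size (by simp), h.size_eq] at hlabels hq
  refine h.of_run ?_ (funext hlabels) ?_ fun v => ?_
  · cases conf <;>
      simp [Writes, symbolCmd, countCmd, tallyCmd, readyCmd, absorbCmd, absorbOneCmd, confirmCmd]
  · rw [symbolCmd, run_seq, run_seq, hq, hq₂, hq₁, h.queries_eq, absorb]
  · rw [absorb]
    dsimp only
    split_ifs
    exacts [h.labels_le u, h.labels_le v]

theorem run_stageCmd (conf : Bool) (h : Represents n W p s) (hu : s.mem element 0 = u)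
    (hun : u < n) :
    Represents n W (stage n W O conf u p) ((stageCmd conf).run O s) := by
  have htest : (Expr.not .curLabel).Holds s.mem ↔ p.labels u = 0 := by
    rw [Expr.holds_not, Expr.Holds, not_not, Expr.val_curLabel, hu, h.labels_eq]
  rw [stage]
  split_ifs with h0
  · rw [stageCmd, run_guard_pos (htest.2 h0), run_seq]
    have hclassify := h.run_classifyCmd (O := O) hu hun
    refine run_forall_lt_of_invariant (n := n) hclassify.size_eq
      (fun i t => Represents n W (absorbs n W O conf u (classify n O u p) i) t)
      (fun i t y ht => ht.set 0 y (by simp)) hclassify fun i hi t hsymbol ht hrep =>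
      hrep.run_symbolCmd conf ?_ hsymbol (Nat.zero_lt_of_lt hi)
    rw [ht element (by cases conf <;> simp [Writes, symbolCmd, countCmd, tallyCmd, readyCmd,
        absorbCmd, absorbOneCmd, confirmCmd]),
      mem_run_of_not_writes (by simp [Writes, classifyCmd, searchCmd]), hu]
  · rwa [stageCmd, run_guard_neg (mt htest.1 h0)]

end Represents

theorem represents_final {n k q : ℕ} (conf : Bool) (c : Fin n → Fin k) (W : Pair n → Fin q) :
    Represents n (sideArray W) (stages n (sideArray W) (oracle c) conf n)
      ((Cmd.mainCmd conf).final c W) := by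
  obtain ⟨hbits, hq⟩ := Cmd.run_bitLengthCmd (O := oracle c) (s := (initState W).store) rfl
  have hframe (a) (ha : a ≠ Arr.bits ∧ a ≠ Arr.power ∧ a ≠ Arr.scan) :
      (Cmd.bitLengthCmd.run (oracle c) (initState W).store).mem a = (initState W).mem a :=
    Cmd.mem_run_of_not_writes (by simp [Cmd.Writes, Cmd.bitLengthCmd, ha]) _
  have hinit : Represents n (sideArray W) (stages n (sideArray W) (oracle c) conf 0)
      (Cmd.bitLengthCmd.run (oracle c) (initState W).store) :=
    { size_eq := by rw [hframe _ (by simp)]; rfl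
      similarity_eq := by rw [hframe _ (by simp)]; rfl
      bits_eq := hbits
      labels_eq := by rw [hframe _ (by simp)]; rfl
      queries_eq := hq
      labels_le := fun _ => Nat.zero_le n }
  exact Cmd.run_forall_lt_of_invariant hinit.size_eq
    (fun i t => Represents n (sideArray W) (stages n (sideArray W) (oracle c) conf i) t)
    (fun i t y ht => ht.set 0 y (by simp)) hinit fun i hi t helement _ ht =>
    ht.run_stageCmd conf helement hi

/-! ### Correctness and number of queries -/

section Count

variable {p q r : ℕ → Prop} [DecidablePred p] [DecidablePred q] [DecidablePred r] {n : ℕ}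

theorem count_congr (h : ∀ k < n, p k ↔ q k) : Nat.count p n = Nat.count q n :=
  (Nat.count_mono_left fun k hk => (h k hk).1).antisymm
    (Nat.count_mono_left fun k hk => (h k hk).2)

theorem count_eq_add (h : ∀ k < n, p k ↔ q k ∨ r k) (hqr : ∀ k < n, q k → ¬ r k) :
    Nat.count p n = Nat.count q n + Nat.count r n := by
  induction n with
  | zero => rfl
  | succ n ih =>
    have := h n n.lt_succ_self
    have := hqr n n.lt_succ_self
    rw [Nat.count_succ, Nat.count_succ, Nat.count_succ,
      ih (fun k hk => h k (hk.trans n.lt_succ_self)) fun k hk => hqr k (hk.trans n.lt_succ_self)]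
    by_cases hq : q n <;> by_cases hr : r n <;> simp_all <;> omega

theorem count_eq_card_fin : Nat.count p n = (Finset.univ.filter fun a : Fin n => p a).card := by
  rw [Nat.count_eq_card_filter_range]
  refine (Finset.card_bij (fun (a : Fin n) _ => (a : ℕ)) (fun a ha => ?_)
    (fun a _ b _ hab => Fin.ext hab) fun a ha => ?_).symm
  · exact Finset.mem_filter.2 ⟨Finset.mem_range.2 a.2, (Finset.mem_filter.1 ha).2⟩
  · rw [Finset.mem_filter, Finset.mem_range] at ha
    exact ⟨⟨a, ha.1⟩, by simp [ha.2], rfl⟩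

theorem count_eq_card_ne {v : ℕ} (hv : ¬ p v) :
    Nat.count p n = (Finset.univ.filter fun a : {a : Fin n // (a : ℕ) ≠ v} => p a).card := by
  rw [count_eq_card_fin]
  refine (Finset.card_bij (fun a _ => a.1) (fun a ha => by simpa using ha)
    (fun a _ b _ h => Subtype.ext h) fun a ha => ?_).symm
  have ha := (Finset.mem_filter.1 ha).2
  exact ⟨⟨a, fun h => hv (h ▸ ha)⟩, by simpa using ha, rfl⟩

theorem count_le_card {α : Type*} {s : Finset α} {g : Fin n → α} (hg : ∀ a : Fin n, p a → g a ∈ s)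
    (hinj : ∀ a b : Fin n, p a → p b → g a = g b → a = b) : Nat.count p n ≤ s.card := by
  rw [count_eq_card_fin]
  refine Finset.card_le_card_of_injOn g (fun a ha => hg a (by simpa using ha)) ?_
  exact fun a ha b hb => hinj a b (by simpa using ha) (by simpa using hb)

end Count

/-- The answers of the oracle describe an equivalence relation on the numbers below `n`. -/
structure IsEquivalenceOracle (n : ℕ) (O : ℕ → ℕ → Bool) : Prop where
  refl : ∀ u < n, O u u = true
  symm : ∀ {u v}, O u v = true → O v u = true
  trans : ∀ {u v w}, O u v = true → O v w = true → O u w = true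

/-- Every label refers to a representative of the right cluster, and every cluster has at most one
label. -/
structure Consistent (n : ℕ) (O : ℕ → ℕ → Bool) (f : ℕ → ℕ) : Prop where
  exists_rep : ∀ v < n, f v ≠ 0 → ∃ r < n, f v = r + 1 ∧ IsRep f r ∧ O v r = true
  label_eq : ∀ v < n, ∀ w < n, f v ≠ 0 → f w ≠ 0 → O v w = true → f v = f w

/-- The number of classified elements. -/
def labelledCount (n : ℕ) (f : ℕ → ℕ) : ℕ := Nat.count (fun v => f v ≠ 0) n

/-- The number of elements of the cluster of `v` before `u`. -/
def rank (O : ℕ → ℕ → Bool) (u v : ℕ) : ℕ := Nat.count (fun a => O a v = true) u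

/-- The elements below `u` preceded by at most `M` elements of their cluster. -/
def earlyCount (O : ℕ → ℕ → Bool) (M u : ℕ) : ℕ := Nat.count (fun a => rank O a a ≤ M) u

/-- The elements that are used to recognise the cluster of `u` at the time when `u` is processed,
if `r` is the representative. -/
def InCore (O : ℕ → ℕ → Bool) (u r a : ℕ) : Prop := a < u + 1 ∧ O a u = true ∧ a ≠ r

instance (O : ℕ → ℕ → Bool) (u r : ℕ) : DecidablePred (InCore O u r) := fun _ => instDecidableAnd

/-- The value of `symbolCount` for a correct clustering. -/
def coreCount (n : ℕ) (W : ℕ → ℕ) (O : ℕ → ℕ → Bool) (u r x v : ℕ) : ℕ :=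
  Nat.count (fun a => InCore O u r a ∧ W (pos n v a) = x) n

/-- The condition on the similarity matrix `W` that makes the algorithm succeed: whenever the test
for a cluster is positive, it separates the cluster from all other elements, and the test is
positive as soon as `M` elements of the cluster have been processed. -/
structure Separates (n : ℕ) (W : ℕ → ℕ) (O : ℕ → ℕ → Bool) (M : ℕ) : Prop where
  separates : ∀ u < n, ∀ r < n, O r u = true → ∀ x, ∀ w < n, ¬ InCore O u r w →
    Far (500 * n.size) (coreCount n W O u r x w) (coreCount n W O u r x r) →
    ∀ v < n, ¬ InCore O u r v →
      (¬ Far (40 * n.size) (coreCount n W O u r x v) (coreCount n W O u r x r) ↔ O v u = true)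
  ready : ∀ u < n, ∀ r < n, O r u = true → M ≤ rank O u u → ∃ v < n, O v u = false ∧
    ∃ x < n, Far (500 * n.size) (coreCount n W O u r x v) (coreCount n W O u r x r)

section Correctness

variable {n : ℕ} {O : ℕ → ℕ → Bool} {W f f' : ℕ → ℕ} {p p' : Progress} {u v w x M K : ℕ}
  {conf : Bool}

theorem IsEquivalenceOracle.rank_congr (hO : IsEquivalenceOracle n O) (h : O v w = true) (u : ℕ) :
    rank O u v = rank O u w :=
  count_congr fun _ _ => ⟨fun h' => hO.trans h' h, fun h' => hO.trans h' (hO.symm h)⟩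

theorem consistent_zero : Consistent n O fun _ => 0 :=
  ⟨fun _ _ h => absurd rfl h, fun _ _ _ _ h => absurd rfl h⟩

theorem Consistent.label_eq_iff (h : Consistent n O f) (hO : IsEquivalenceOracle n O)
    (hv : v < n) (hw : w < n) (hv0 : f v ≠ 0) (hw0 : f w ≠ 0) : f v = f w ↔ O v w = true := by
  refine ⟨fun heq => ?_, h.label_eq v hv w hw hv0 hw0⟩
  obtain ⟨r, -, hvr, -, hor⟩ := h.exists_rep v hv hv0
  obtain ⟨r', -, hwr, -, hor'⟩ := h.exists_rep w hw hw0
  obtain rfl : r = r' := by omega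
  exact hO.trans hor (hO.symm hor')

theorem Consistent.extend (h : Consistent n O f) (hO : IsEquivalenceOracle n O)
    (h' : ∀ v < n, f' v = f v ∨ f v = 0 ∧ ∃ w < n, f w ≠ 0 ∧ f' v = f w ∧ O v w = true) :
    Consistent n O f' := by
  have hkeep : ∀ v < n, f v ≠ 0 → f' v = f v := fun v hv h0 =>
    (h' v hv).resolve_right fun h'' => h0 h''.1
  have hsource : ∀ v < n, f' v ≠ 0 → ∃ w < n, f w ≠ 0 ∧ f' v = f w ∧ O v w = true := by
    intro v hv h0
    rcases h' v hv with heq | ⟨-, hw⟩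
    · exact ⟨v, hv, heq ▸ h0, heq, hO.refl v hv⟩
    · exact hw
  refine ⟨fun v hv h0 => ?_, fun v hv w hw hv0 hw0 ho => ?_⟩
  · obtain ⟨w, hw, hw0, heq, hvw⟩ := hsource v hv h0
    obtain ⟨r, hr, hwr, hrep, hor⟩ := h.exists_rep w hw hw0
    have hrep' : IsRep f' r := (hkeep r hr (by rw [hrep]; omega)).trans hrep
    exact ⟨r, hr, heq.trans hwr, hrep', hO.trans hvw hor⟩
  · obtain ⟨v', hv', hv0', hv, hov⟩ := hsource v hv hv0
    obtain ⟨w', hw', hw0', hw, how⟩ := hsource w hw hw0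
    rw [hv, hw, h.label_eq v' hv' w' hw' hv0' hw0' (hO.trans (hO.symm hov) (hO.trans ho how))]

theorem Consistent.update_new (h : Consistent n O f) (hO : IsEquivalenceOracle n O) (hu : u < n)
    (hu0 : f u = 0) (hnew : ∀ w < n, f w ≠ 0 → O u w = false) :
    Consistent n O (Function.update f u (u + 1)) := by
  refine ⟨fun v hv h0 => ?_, fun v hv w hw hv0 hw0 ho => ?_⟩
  · by_cases hvu : v = u
    · subst hvu
      exact ⟨v, hv, Function.update_self .., Function.update_self .., hO.refl v hv⟩
    · rw [Function.update_of_ne hvu] at h0 ⊢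
      obtain ⟨r, hr, hvr, hrep, hor⟩ := h.exists_rep v hv h0
      have hru : r ≠ u := by rintro rfl; rw [IsRep] at hrep; omega
      exact ⟨r, hr, hvr, by rwa [IsRep, Function.update_of_ne hru], hor⟩
  · by_cases hvu : v = u <;> by_cases hwu : w = u
    · rw [hvu, hwu]
    · rw [Function.update_of_ne hwu] at hw0
      simp [hvu, hnew w hw hw0] at ho
    · rw [Function.update_of_ne hvu] at hv0
      have ho' := hO.symm ho
      simp [hwu, hnew v hv hv0] at ho'
    · rw [Function.update_of_ne hvu] at hv0 ⊢
      rw [Function.update_of_ne hwu] at hw0 ⊢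
      exact h.label_eq v hv w hw hv0 hw0 ho

theorem findLabel_spec (h0 : findLabel n O f u ≠ 0) :
    ∃ r < n, findLabel n O f u = r + 1 ∧ IsRep f r ∧ O u r = true := by
  obtain ⟨hrep, ho⟩ := Nat.findGreatest_of_ne_zero (P := fun l => IsRep f (l - 1) ∧
    O u (l - 1) = true) rfl h0
  have hle : findLabel n O f u ≤ n := Nat.findGreatest_le n
  exact ⟨findLabel n O f u - 1, by omega, by omega, hrep, ho⟩

theorem oracle_eq_false_of_findLabel_eq_zero (h0 : findLabel n O f u = 0) {r : ℕ} (hr : r < n)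
    (hrep : IsRep f r) : O u r = false := by
  have := Nat.findGreatest_eq_zero_iff.1 h0 r.succ_pos hr
  simpa [hrep] using this

theorem Consistent.classify (h : Consistent n O p.labels) (hO : IsEquivalenceOracle n O)
    (hu : u < n) (hu0 : p.labels u = 0) : Consistent n O (classify n O u p).labels := by
  rw [QueryCluster.classify]
  dsimp only
  split_ifs with h0
  · refine h.update_new hO hu hu0 fun w hw hw0 => ?_
    obtain ⟨r, hr, -, hrep, hor⟩ := h.exists_rep w hw hw0
    by_contra ho
    rw [Bool.not_eq_false] at ho
    simpa [hO.trans ho hor] using oracle_eq_false_of_findLabel_eq_zero h0 hr hrep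
  · obtain ⟨r, hr, hlabel, hrep, hor⟩ := findLabel_spec h0
    refine h.extend hO fun v _ => ?_
    by_cases hvu : v = u
    · subst hvu
      have hr0 : p.labels r ≠ 0 := by rw [hrep]; omega
      exact Or.inr ⟨hu0, r, hr, hr0, by rw [Function.update_self, hlabel, hrep], hor⟩
    · exact Or.inl (Function.update_of_ne hvu _ _)

theorem labels_classify_self_ne_zero : (classify n O u p).labels u ≠ 0 := by
  rw [classify]
  dsimp only
  rw [Function.update_self]
  split_ifs with h0
  exacts [u.succ_ne_zero, h0]

theorem labels_classify_of_ne (hv : v ≠ u) : (classify n O u p).labels v = p.labels v :=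
  Function.update_of_ne hv _ _

theorem labels_classify_ne_zero (hv : p.labels v ≠ 0) : (classify n O u p).labels v ≠ 0 := by
  by_cases hvu : v = u
  · exact hvu ▸ labels_classify_self_ne_zero
  · rwa [labels_classify_of_ne hvu]

theorem labels_absorb_ne_zero (hu : p.labels u ≠ 0) (hv : p.labels v ≠ 0) :
    (absorb n W O conf u x p).labels v ≠ 0 := by
  rw [absorb]
  dsimp only
  split_ifs
  exacts [hu, hv]

theorem Consistent.absorb (h : Consistent n O p.labels) (hO : IsEquivalenceOracle n O) (hu : u < n)
    (hu0 : p.labels u ≠ 0)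
    (hsound : ∀ v < n, IsCandidate n W p.labels u x v →
      (conf = true → O v (p.labels u - 1) = true) → O v u = true) :
    Consistent n O (absorb n W O conf u x p).labels := by
  refine h.extend hO fun v hv => ?_
  rw [QueryCluster.absorb]
  dsimp only
  split_ifs with hif
  · exact Or.inr ⟨hif.2.1.2.1, u, hu, hu0, rfl, hsound v hv hif.2.1 hif.2.2⟩
  · exact Or.inl rfl

theorem Consistent.oracle_rep (h : Consistent n O f) (hu : u < n) (hu0 : f u ≠ 0) :
    O u (f u - 1) = true := by
  obtain ⟨r, -, hur, -, hor⟩ := h.exists_rep u hu hu0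
  rwa [hur]

theorem consistent_absorbs_true (hO : IsEquivalenceOracle n O) (h : Consistent n O p.labels)
    (hu : u < n) (hu0 : p.labels u ≠ 0) (i : ℕ) :
    Consistent n O (absorbs n W O true u p i).labels ∧
      ∀ v, p.labels v ≠ 0 → (absorbs n W O true u p i).labels v ≠ 0 := by
  induction i with
  | zero => exact ⟨h, fun v hv => hv⟩
  | succ x ih =>
    have hu0' := ih.2 u hu0
    refine ⟨ih.1.absorb hO hu hu0' fun v _ _ ho => ?_,
      fun v hv => labels_absorb_ne_zero hu0' (ih.2 v hv)⟩
    exact hO.trans (ho rfl) (hO.symm (ih.1.oracle_rep hu hu0'))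

theorem consistent_stages_true (hO : IsEquivalenceOracle n O) {i : ℕ} (hi : i ≤ n) :
    Consistent n O (stages n W O true i).labels ∧ ∀ v < i, (stages n W O true i).labels v ≠ 0 := by
  induction i with
  | zero => exact ⟨consistent_zero, by simp⟩
  | succ u ih =>
    obtain ⟨hc, hlabelled⟩ := ih (by omega)
    rw [stages, stage]
    split_ifs with h0
    · obtain ⟨hc', hmono⟩ := consistent_absorbs_true (W := W) hO (hc.classify hO hi h0) hi
        labels_classify_self_ne_zero n
      refine ⟨hc', fun v hv => hmono v ?_⟩
      rcases Nat.lt_succ_iff_lt_or_eq.1 hv with hv | rfl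
      exacts [labels_classify_ne_zero (hlabelled v hv), labels_classify_self_ne_zero]
    · refine ⟨hc, fun v hv => ?_⟩
      rcases Nat.lt_succ_iff_lt_or_eq.1 hv with hv | rfl
      exacts [hlabelled v hv, h0]

theorem Consistent.symbolCount_eq (h : Consistent n O f) (hO : IsEquivalenceOracle n O)
    (hu : u < n) (hlabelled : ∀ v < u + 1, f v ≠ 0) (W : ℕ → ℕ) (x v : ℕ) :
    symbolCount n W f u x v = coreCount n W O u (f u - 1) x v := by
  have hu0 := hlabelled u u.lt_succ_self
  refine count_congr fun a ha => ?_
  rw [InCore, and_assoc, and_assoc]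
  refine and_congr_right fun hau => ?_
  rw [h.label_eq_iff hO ha hu (hlabelled a hau) hu0]
  exact and_congr_right fun _ => and_congr_left fun _ => by omega

theorem Separates.isCandidate_iff (hW : Separates n W O M) (hO : IsEquivalenceOracle n O)
    (h : Consistent n O f) (hu : u < n) (hlabelled : ∀ v < u + 1, f v ≠ 0)
    (hready : Ready n W f u x) (hv : v < n) :
    IsCandidate n W f u x v ↔ f v = 0 ∧ O v u = true := by
  have hu0 := hlabelled u u.lt_succ_self
  obtain ⟨r, hr, hur, -, hor⟩ := h.exists_rep u hu hu0
  rw [IsCandidate, and_iff_right hready]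
  refine and_congr_right fun hv0 => ?_
  obtain ⟨w, hw, hwu, hfar⟩ := hready
  simp only [h.symbolCount_eq hO hu hlabelled, hur, Nat.add_sub_cancel] at hfar ⊢
  refine hW.separates u hu r hr (hO.symm hor) x w hw (fun hcore => hwu ?_) hfar v hv
    fun hcore => hlabelled v hcore.1 hv0
  exact h.label_eq w hw u hu (hlabelled w hcore.1) hu0 hcore.2.1

/-- The progress from `p` to `p'` consists in the classification of elements of the cluster of `u`,
each of them at the cost of one query if `conf` is set. -/
structure Extends (n : ℕ) (O : ℕ → ℕ → Bool) (conf : Bool) (u : ℕ) (p p' : Progress) : Prop where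
  consistent : Consistent n O p'.labels
  mono : ∀ v, p.labels v ≠ 0 → p'.labels v ≠ 0
  same_cluster : ∀ v, p'.labels v ≠ 0 → p.labels v ≠ 0 ∨ O v u = true
  queries : p'.queries + (if conf then labelledCount n p.labels else 0) =
    p.queries + if conf then labelledCount n p'.labels else 0

theorem Separates.extends_absorb (hW : Separates n W O M) (hO : IsEquivalenceOracle n O)
    (h : Consistent n O p.labels) (hu : u < n) (hlabelled : ∀ v < u + 1, p.labels v ≠ 0) (x : ℕ) :
    Extends n O conf u p (absorb n W O conf u x p) := by
  have hu0 := hlabelled u u.lt_succ_self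
  have hsound (v) (hv : v < n) (hcand : IsCandidate n W p.labels u x v) : O v u = true :=
    ((hW.isCandidate_iff hO h hu hlabelled hcand.1 hv).1 hcand).2
  have hlabels (v) : (absorb n W O conf u x p).labels v =
      if v < n ∧ IsCandidate n W p.labels u x v then p.labels u else p.labels v :=
    if_congr (and_congr_right fun hv => and_iff_left_of_imp fun hcand _ =>
      hO.trans (hsound v hv hcand) (h.oracle_rep hu hu0)) rfl rfl
  refine ⟨h.absorb hO hu hu0 fun v hv hcand _ => hsound v hv hcand,
    fun v hv => labels_absorb_ne_zero hu0 hv, fun v hv => ?_, ?_⟩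
  · rw [hlabels] at hv
    split_ifs at hv with hif
    exacts [Or.inr (hsound v hif.1 hif.2), Or.inl hv]
  · have hcount : labelledCount n (absorb n W O conf u x p).labels =
        labelledCount n p.labels + Nat.count (IsCandidate n W p.labels u x) n := by
      refine count_eq_add (fun v hv => ?_) fun v _ hv0 hcand => hv0 hcand.2.1
      rw [hlabels]
      split_ifs with hif
      · simp [hu0, hif.2]
      · rw [or_iff_left fun hcand => hif ⟨hv, hcand⟩]
    rw [hcount]
    have hq : (absorb n W O conf u x p).queries = p.queries +
      if conf then Nat.count (IsCandidate n W p.labels u x) n else 0 := rfl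
    split_ifs at hq ⊢ <;> omega

theorem Separates.absorb_of_ready (hW : Separates n W O M) (hO : IsEquivalenceOracle n O)
    (h : Consistent n O p.labels) (hu : u < n) (hlabelled : ∀ v < u + 1, p.labels v ≠ 0)
    (hready : Ready n W p.labels u x) (hv : v < n) (ho : O v u = true) :
    (absorb n W O conf u x p).labels v ≠ 0 := by
  have hu0 := hlabelled u u.lt_succ_self
  by_cases hv0 : p.labels v = 0
  · rw [absorb]
    dsimp only
    rwa [if_pos ⟨hv, (hW.isCandidate_iff hO h hu hlabelled hready hv).2 ⟨hv0, ho⟩,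
      fun _ => hO.trans ho (h.oracle_rep hu hu0)⟩]
  · exact labels_absorb_ne_zero hu0 hv0

theorem absorb_of_not_ready (h : ¬ Ready n W p.labels u x) : absorb n W O conf u x p = p := by
  have hcand (v) : ¬ IsCandidate n W p.labels u x v := fun hcand => h hcand.1
  ext <;> simp [absorb, hcand, Nat.count_iff_forall_not]

theorem Separates.extends_absorbs (hW : Separates n W O M) (hO : IsEquivalenceOracle n O)
    (h : Consistent n O p.labels) (hu : u < n) (hlabelled : ∀ v < u + 1, p.labels v ≠ 0) (i : ℕ) :
    Extends n O conf u p (absorbs n W O conf u p i) := by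
  induction i with
  | zero => exact ⟨h, fun v hv => hv, fun v hv => Or.inl hv, rfl⟩
  | succ x ih =>
    have ih' := hW.extends_absorb (conf := conf) hO ih.consistent hu
      (fun v hv => ih.mono v (hlabelled v hv)) x
    refine ⟨ih'.consistent, fun v hv => ih'.mono v (ih.mono v hv),
      fun v hv => (ih'.same_cluster v hv).elim (ih.same_cluster v) Or.inr, ?_⟩
    have hq := ih.queries
    have hq' := ih'.queries
    rw [absorbs]
    omega

theorem Separates.absorbs_complete (hW : Separates n W O M) (hO : IsEquivalenceOracle n O)
    (h : Consistent n O p.labels) (hu : u < n) (hlabelled : ∀ v < u + 1, p.labels v ≠ 0) (i : ℕ) :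
    (∀ x < i, ¬ Ready n W p.labels u x) ∧ absorbs n W O conf u p i = p ∨
      ∀ v < n, O v u = true → (absorbs n W O conf u p i).labels v ≠ 0 := by
  induction i with
  | zero => exact Or.inl ⟨by simp, rfl⟩
  | succ x ih =>
    rw [absorbs]
    rcases ih with ⟨hnot, heq⟩ | hcomplete
    · rw [heq]
      by_cases hready : Ready n W p.labels u x
      · exact Or.inr fun v hv ho => hW.absorb_of_ready hO h hu hlabelled hready hv ho
      · refine Or.inl ⟨fun y hy => ?_, absorb_of_not_ready hready⟩
        rcases Nat.lt_succ_iff_lt_or_eq.1 hy with hy | rfl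
        exacts [hnot y hy, hready]
    · have hext := hW.extends_absorbs (conf := conf) hO h hu hlabelled x
      exact Or.inr fun v hv ho => labels_absorb_ne_zero
        (hext.mono u (hlabelled u u.lt_succ_self)) (hcomplete v hv ho)

/-- The situation before the element `u` is processed: apart from clusters of which at most `M`
elements have been seen, the clusters with an element below `u` are complete. -/
structure StageInvariant (n : ℕ) (O : ℕ → ℕ → Bool) (M u : ℕ) (f : ℕ → ℕ) : Prop where
  consistent : Consistent n O f
  labelled : ∀ v < u, f v ≠ 0
  complete : ∀ v < n, u ≤ v → f v ≠ 0 → ∀ w < n, O w v = true → f w ≠ 0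
  rank_le : ∀ v < n, f v = 0 → rank O u v ≤ M

theorem StageInvariant.of_labelled (h : StageInvariant n O M u f) (hO : IsEquivalenceOracle n O)
    (hu : u < n) (hu0 : f u ≠ 0) : StageInvariant n O M (u + 1) f where
  consistent := h.consistent
  labelled v hv := by
    rcases Nat.lt_succ_iff_lt_or_eq.1 hv with hv | rfl
    exacts [h.labelled v hv, hu0]
  complete v hv huv := h.complete v hv (by omega)
  rank_le v hv hv0 := by
    have ho : ¬ O u v = true := fun ho => h.complete u hu le_rfl hu0 v hv (hO.symm ho) hv0
    rw [rank, Nat.count_succ, if_neg ho]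
    exact h.rank_le v hv hv0

theorem Separates.rank_lt_of_not_ready (hW : Separates n W O M) (hO : IsEquivalenceOracle n O)
    (h : Consistent n O f) (hu : u < n) (hlabelled : ∀ v < u + 1, f v ≠ 0)
    (hnot : ∀ x < n, ¬ Ready n W f u x) : rank O u u < M := by
  by_contra! hM
  have hu0 := hlabelled u u.lt_succ_self
  obtain ⟨r, hr, hur, -, hor⟩ := h.exists_rep u hu hu0
  obtain ⟨v, hv, hvu, x, hx, hfar⟩ := hW.ready u hu r hr (hO.symm hor) hM
  refine hnot x hx ⟨v, hv, fun heq => ?_, ?_⟩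
  · simp [(h.label_eq_iff hO hv hu (heq ▸ hu0) hu0).1 heq] at hvu
  · rwa [h.symbolCount_eq hO hu hlabelled, h.symbolCount_eq hO hu hlabelled, hur,
      Nat.add_sub_cancel]

theorem StageInvariant.of_absorbs (h : StageInvariant n O M u p.labels)
    (hW : Separates n W O M) (hO : IsEquivalenceOracle n O) (hu : u < n) (hu0 : p.labels u = 0) :
    StageInvariant n O M (u + 1) (absorbs n W O conf u (classify n O u p) n).labels := by
  have hc := h.consistent.classify hO hu hu0
  have hlabelled (v) (hv : v < u + 1) : (classify n O u p).labels v ≠ 0 := by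
    rcases Nat.lt_succ_iff_lt_or_eq.1 hv with hv | rfl
    exacts [labels_classify_ne_zero (h.labelled v hv), labels_classify_self_ne_zero]
  have hext := hW.extends_absorbs (conf := conf) hO hc hu hlabelled n
  have hcomplete := hW.absorbs_complete (conf := conf) hO hc hu hlabelled n
  have hmono (v) (hv : p.labels v ≠ 0) := hext.mono v (labels_classify_ne_zero hv)
  have hold (v) (hvu : u + 1 ≤ v) (hv : (classify n O u p).labels v ≠ 0) : p.labels v ≠ 0 := by
    rwa [labels_classify_of_ne (by omega)] at hv
  refine ⟨hext.consistent, fun v hv => hext.mono v (hlabelled v hv),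
    fun v hv huv hv0 w hw how => ?_, fun v hv hv0 => ?_⟩
  · rcases hcomplete with ⟨-, heq⟩ | hcomplete
    · rw [heq] at hv0
      exact hmono w (h.complete v hv (by omega) (hold v huv hv0) w hw how)
    · rcases hext.same_cluster v hv0 with hv0 | ho
      · exact hmono w (h.complete v hv (by omega) (hold v huv hv0) w hw how)
      · exact hcomplete w hw (hO.trans how ho)
  · have hrank := h.rank_le v hv (not_not.1 fun hv0' => hmono v hv0' hv0)
    rw [rank, Nat.count_succ, ← rank]
    split_ifs with ho
    · rw [← hO.rank_congr ho]
      rcases hcomplete with ⟨hnot, -⟩ | hcomplete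
      · exact hW.rank_lt_of_not_ready hO hc hu hlabelled hnot
      · exact absurd hv0 (hcomplete v hv (hO.symm ho))
    · exact hrank

theorem Separates.queries_absorbs_le (hW : Separates n W O M) (hO : IsEquivalenceOracle n O)
    (h : StageInvariant n O M u p.labels) (hu : u < n) (hu0 : p.labels u = 0) :
    (absorbs n W O conf u (classify n O u p) n).queries +
        (if conf then labelledCount n p.labels else 0) ≤
      p.queries + repCount n p.labels +
        if conf then labelledCount n (absorbs n W O conf u (classify n O u p) n).labels else 0 := by
  have hq := (hW.extends_absorbs (conf := conf) hO (h.consistent.classify hO hu hu0) hu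
    (fun v hv => by
      rcases Nat.lt_succ_iff_lt_or_eq.1 hv with hv | rfl
      exacts [labels_classify_ne_zero (h.labelled v hv), labels_classify_self_ne_zero]) n).queries
  have hmono : labelledCount n p.labels ≤ labelledCount n (classify n O u p).labels :=
    Nat.count_mono_left fun v _ => labels_classify_ne_zero
  have hclassify : (classify n O u p).queries = p.queries + repCount n p.labels := rfl
  split_ifs at hq ⊢ <;> omega

theorem Separates.stageInvariant_stages (hW : Separates n W O M) (hO : IsEquivalenceOracle n O)
    (hK : ∀ f, Consistent n O f → repCount n f ≤ K) (conf : Bool) {i : ℕ} (hi : i ≤ n) :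
    StageInvariant n O M i (stages n W O conf i).labels ∧ (stages n W O conf i).queries ≤
      K * earlyCount O M i + if conf then labelledCount n (stages n W O conf i).labels else 0 := by
  induction i with
  | zero =>
    exact ⟨⟨consistent_zero, by simp, fun _ _ _ h => absurd rfl h, by simp [rank]⟩,
      Nat.zero_le _⟩
  | succ u ih =>
    obtain ⟨hinv, hq⟩ := ih (by omega)
    rw [stages, stage, earlyCount, Nat.count_succ, ← earlyCount]
    by_cases h0 : (stages n W O conf u).labels u = 0
    · rw [if_pos h0, if_pos (hinv.rank_le u hi h0), mul_add, mul_one]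
      have hq' := hW.queries_absorbs_le (conf := conf) hO hinv hi h0
      have hrep := hK _ hinv.consistent
      exact ⟨hinv.of_absorbs hW hO hi h0, by omega⟩
    · rw [if_neg h0]
      refine ⟨hinv.of_labelled hO hi h0, hq.trans ?_⟩
      gcongr
      omega

theorem Separates.queries_stages_le (hW : Separates n W O M) (hO : IsEquivalenceOracle n O)
    (hK : ∀ f, Consistent n O f → repCount n f ≤ K) (conf : Bool) :
    (stages n W O conf n).queries ≤ K * earlyCount O M n + if conf then n else 0 := by
  refine (hW.stageInvariant_stages hO hK conf le_rfl).2.trans ?_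
  gcongr
  split_ifs
  exacts [Nat.count_le _, le_rfl]

end Correctness

/-! ### Sub-Poisson random variables -/

section Subpoisson

open ProbabilityTheory Real

variable {Ω ι : Type*} [MeasurableSpace Ω] {μ : Measure Ω} {X : Ω → ℝ} {m y ρ : ℝ}

/-- The exponential moments of the random variable `X` are at most those of the Poisson distribution
with mean `m`. Sums of independent indicators are the main example. -/
structure HasSubpoissonMGF (X : Ω → ℝ) (m : ℝ) (μ : Measure Ω) : Prop where
  integrable_exp_mul : ∀ t, Integrable (fun ω => exp (t * X ω)) μ
  mgf_le : ∀ t, mgf X μ t ≤ exp (m * (exp t - 1))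

theorem hasSubpoissonMGF_indicator [IsProbabilityMeasure μ] {A : Set Ω} (hA : MeasurableSet A) :
    HasSubpoissonMGF (A.indicator 1) (μ.real A) μ := by
  have hexp (t : ℝ) : (fun ω => exp (t * A.indicator 1 ω)) =
      fun ω => 1 + A.indicator (fun _ => exp t - 1) ω := by
    ext ω
    by_cases hω : ω ∈ A <;> simp [hω]
  have hint (t : ℝ) : Integrable (A.indicator fun _ => exp t - 1) μ :=
    (integrable_const _).indicator hA
  refine ⟨fun t => ?_, fun t => ?_⟩
  · rw [hexp]
    exact (integrable_const _).add (hint t)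
  · calc mgf (A.indicator 1) μ t = μ.real A * (exp t - 1) + 1 := by
          rw [mgf, hexp, integral_add (integrable_const _) (hint t), integral_indicator_const _ hA]
          simp [add_comm]
      _ ≤ exp (μ.real A * (exp t - 1)) := add_one_le_exp _

theorem HasSubpoissonMGF.sum {X : ι → Ω → ℝ} {m : ι → ℝ} {s : Finset ι} (hindep : iIndepFun X μ)
    (hmeas : ∀ i, Measurable (X i)) (h : ∀ i ∈ s, HasSubpoissonMGF (X i) (m i) μ) :
    HasSubpoissonMGF (∑ i ∈ s, X i) (∑ i ∈ s, m i) μ where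
  integrable_exp_mul t :=
    have := hindep.isProbabilityMeasure
    hindep.integrable_exp_mul_sum hmeas fun i hi => (h i hi).integrable_exp_mul t
  mgf_le t := by
    rw [hindep.mgf_sum hmeas, Finset.sum_mul, exp_sum]
    exact Finset.prod_le_prod (fun _ _ => mgf_nonneg) fun i hi => (h i hi).mgf_le t

/-- The left side is the Chernoff exponent for the deviation of a Poisson variable with mean `m` to
`y ^ 2`, at the optimal parameter `log (y ^ 2 / m)`. -/
theorem chernoff_exponent_le (hm : 0 < m) (hy : 0 < y) :
    -log (y ^ 2 / m) * y ^ 2 + m * (exp (log (y ^ 2 / m)) - 1) ≤ -(y - √m) ^ 2 := by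
  have : 0 < √m := sqrt_pos.2 hm
  have hsq : √m ^ 2 = m := sq_sqrt hm.le
  have hlog : log (y ^ 2 / m) = 2 * log (y / √m) := by
    rw [← log_rpow (by positivity), rpow_two, div_pow, hsq]
  have hle : y ^ 2 - √m * y ≤ log (y / √m) * y ^ 2 := by
    calc y ^ 2 - √m * y = (1 - (y / √m)⁻¹) * y ^ 2 := by field_simp
      _ ≤ log (y / √m) * y ^ 2 := by gcongr; exact one_sub_inv_le_log_of_pos (by positivity)
  have hmean : m * (y ^ 2 / m - 1) = y ^ 2 - m := by field_simp
  rw [exp_log (by positivity), hlog, hmean]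
  linarith

variable [IsFiniteMeasure μ]

theorem HasSubpoissonMGF.measure_sqrt_add_lt_le (h : HasSubpoissonMGF X m μ) (hρ : 0 ≤ ρ) :
    μ.real {ω | √m + ρ < √(X ω)} ≤ exp (-ρ ^ 2) := by
  set y := √m + ρ with hy
  have hy0 : 0 ≤ y := by positivity
  have hchernoff {t : ℝ} (ht : 0 ≤ t) :
      μ.real {ω | y < √(X ω)} ≤ exp (-t * y ^ 2 + m * (exp t - 1)) := by
    calc μ.real {ω | y < √(X ω)} ≤ μ.real {ω | y ^ 2 ≤ X ω} :=
          measureReal_mono fun ω hω => ((lt_sqrt hy0).1 hω).le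
      _ ≤ exp (-t * y ^ 2) * mgf X μ t :=
          measure_ge_le_exp_mul_mgf _ ht (h.integrable_exp_mul t)
      _ ≤ exp (-t * y ^ 2) * exp (m * (exp t - 1)) := by gcongr; exact h.mgf_le t
      _ = _ := (exp_add _ _).symm
  rcases le_or_gt m 0 with hm | hm
  · refine (hchernoff zero_le_one).trans (exp_le_exp.2 ?_)
    have : m * (exp 1 - 1) ≤ 0 :=
      mul_nonpos_of_nonpos_of_nonneg hm (by linarith [one_le_exp zero_le_one])
    rw [hy, sqrt_eq_zero_of_nonpos hm]
    linarith
  · have hmy : m ≤ y ^ 2 := (sqrt_le_left hy0).1 (by linarith)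
    refine (hchernoff (log_nonneg ((one_le_div hm).2 hmy))).trans (exp_le_exp.2 ?_)
    refine (chernoff_exponent_le hm (by positivity)).trans_eq ?_
    rw [hy, add_sub_cancel_left]

theorem HasSubpoissonMGF.measure_lt_sqrt_sub_le (h : HasSubpoissonMGF X m μ) (hρ : 0 ≤ ρ) :
    μ.real {ω | √(X ω) < √m - ρ} ≤ exp (-ρ ^ 2) := by
  set y := √m - ρ with hy
  rcases le_or_gt y 0 with hy0 | hy0
  · have hempty : {ω | √(X ω) < y} = ∅ :=
      Set.eq_empty_of_forall_notMem fun ω hω => (hω.trans_le hy0).not_ge (sqrt_nonneg _)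
    rw [hempty, measureReal_empty]
    positivity
  · have hm : 0 < m := sqrt_pos.1 (by linarith)
    have hym : y ^ 2 ≤ m := (le_sqrt' hy0).1 (by linarith)
    have ht : log (y ^ 2 / m) ≤ 0 := log_nonpos (by positivity) ((div_le_one hm).2 hym)
    calc μ.real {ω | √(X ω) < y} ≤ μ.real {ω | X ω ≤ y ^ 2} :=
          measureReal_mono fun ω hω => ((sqrt_lt' hy0).1 hω).le
      _ ≤ exp (-log (y ^ 2 / m) * y ^ 2) * mgf X μ (log (y ^ 2 / m)) :=
          measure_le_le_exp_mul_mgf _ ht (h.integrable_exp_mul _)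
      _ ≤ exp (-log (y ^ 2 / m) * y ^ 2) * exp (m * (exp (log (y ^ 2 / m)) - 1)) := by
          gcongr; exact h.mgf_le _
      _ ≤ exp (-(y - √m) ^ 2) := by
          rw [← exp_add]
          exact exp_le_exp.2 (chernoff_exponent_le hm hy0)
      _ = exp (-ρ ^ 2) := by rw [hy, sub_sub_cancel_left, neg_sq]

theorem HasSubpoissonMGF.measure_lt_abs_sqrt_sub_sqrt_le (h : HasSubpoissonMGF X m μ)
    (hρ : 0 ≤ ρ) : μ.real {ω | ρ < |√(X ω) - √m|} ≤ 2 * exp (-ρ ^ 2) := by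
  calc μ.real {ω | ρ < |√(X ω) - √m|}
      ≤ μ.real ({ω | √m + ρ < √(X ω)} ∪ {ω | √(X ω) < √m - ρ}) :=
        measureReal_mono fun ω hω =>
          (lt_abs.1 hω).imp lt_sub_iff_add_lt'.1 fun h => lt_sub_comm.1 (neg_sub √(X ω) _ ▸ h)
    _ ≤ exp (-ρ ^ 2) + exp (-ρ ^ 2) := (measureReal_union_le _ _).trans
        (add_le_add (h.measure_sqrt_add_lt_le hρ) (h.measure_lt_sqrt_sub_le hρ))
    _ = 2 * exp (-ρ ^ 2) := (two_mul _).symm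

theorem hasSubpoissonMGF_sum_indicator_eval {κ α : Type*} [Fintype ι] [MeasurableSpace α]
    {ν : ι → Measure α} [∀ i, IsProbabilityMeasure (ν i)] {A : Set α} (hA : MeasurableSet A)
    {e : κ → ι} (he : e.Injective) {s : Finset κ} {p : ℝ} (hp : ∀ a ∈ s, (ν (e a)).real A = p) :
    HasSubpoissonMGF (∑ a ∈ s, fun W => A.indicator 1 (W (e a))) (s.card * p) (Measure.pi ν) := by
  have hmeas : Measurable (A.indicator (1 : α → ℝ)) := measurable_one.indicator hA
  rw [← nsmul_eq_mul, ← Finset.sum_const]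
  refine .sum ((iIndepFun_pi fun i => hmeas.aemeasurable).precomp he)
    (fun a => hmeas.comp (measurable_pi_apply (e a))) fun a ha => ?_
  rw [← hp a ha, ← (measurePreserving_eval ν (e a)).measureReal_preimage hA.nullMeasurableSet]
  exact hasSubpoissonMGF_indicator (hA.preimage (measurable_pi_apply (e a)))

end Subpoisson

/-! ### Oracles of clusterings -/

section Oracle

variable {n k : ℕ} (c : Fin n → Fin k)

@[simp] theorem oracle_val (u v : Fin n) : oracle c u v = true ↔ c u = c v := by
  simp [oracle]

theorem isEquivalenceOracle_oracle : IsEquivalenceOracle n (oracle c) where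
  refl u hu := (oracle_val c ⟨u, hu⟩ ⟨u, hu⟩).2 rfl
  symm {u v} h := by
    unfold oracle at h ⊢
    split_ifs at h with huv
    simpa [huv] using (of_decide_eq_true h).symm
  trans {u v w} huv hvw := by
    unfold oracle at huv hvw ⊢
    split_ifs at huv hvw with hu hw
    simpa [hu, hw] using (of_decide_eq_true huv).trans (of_decide_eq_true hvw)

variable {c} in
theorem Consistent.repCount_le {f : ℕ → ℕ} (h : Consistent n (oracle c) f) :
    repCount n f ≤ (Finset.univ.image c).card := by
  refine count_le_card (g := c) (fun a _ => Finset.mem_image_of_mem c (Finset.mem_univ a))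
    fun a b ha hb hab => ?_
  rw [IsRep] at ha hb
  have hlabel := h.label_eq a a.2 b b.2 (by omega) (by omega) ((oracle_val c a b).2 hab)
  omega

theorem earlyCount_le (M : ℕ) : earlyCount (oracle c) M n ≤ k * (M + 1) := by
  have hO := isEquivalenceOracle_oracle c
  have hlt {a b : Fin n} (hab : a < b) (h : c a = c b) :
      rank (oracle c) a a < rank (oracle c) b b := by
    have ho := (oracle_val c a b).2 h
    rw [hO.rank_congr ho]
    exact Nat.count_strict_mono ho hab
  calc earlyCount (oracle c) M n
      ≤ ((Finset.univ : Finset (Fin k)) ×ˢ Finset.range (M + 1)).card :=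
        count_le_card (g := fun a => (c a, rank (oracle c) a a))
          (fun a ha => by simpa using Nat.lt_succ_of_le ha) fun a b _ _ hab => by
            rw [Prod.mk.injEq] at hab
            rcases lt_trichotomy a b with h | h | h
            exacts [absurd hab.2 (hlt h hab.1).ne, h, absurd hab.2 (hlt h hab.1.symm).ne']
    _ = k * (M + 1) := by simp

theorem inCore_oracle {u r a : Fin n} :
    InCore (oracle c) u r a ↔ a ≤ u ∧ c a = c u ∧ a ≠ r := by
  rw [InCore, oracle_val, Nat.lt_succ_iff, Fin.le_def, ← Fin.val_ne_iff]

end Oracle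

/-- The number of elements that are used to recognise the cluster of `u`. -/
def coreSize (n : ℕ) (O : ℕ → ℕ → Bool) (u r : ℕ) : ℕ := Nat.count (InCore O u r) n

theorem rank_le_coreSize {n : ℕ} {O : ℕ → ℕ → Bool} (hO : IsEquivalenceOracle n O) {u : ℕ}
    (hu : u < n) (r : ℕ) : rank O u u ≤ coreSize n O u r := by
  have hsucc : rank O u u + 1 = ((Finset.range (u + 1)).filter fun a => O a u = true).card := by
    rw [← Nat.count_eq_card_filter_range, Nat.count_succ, if_pos (hO.refl u hu), rank]
  have hsub : ((Finset.range (u + 1)).filter fun a => O a u = true).erase r ⊆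
      (Finset.range n).filter (InCore O u r) := fun a ha => by
    simp only [Finset.mem_erase, Finset.mem_filter, Finset.mem_range, InCore] at ha ⊢
    exact ⟨by omega, ha.2.1, ha.2.2, ha.1⟩
  calc rank O u u = ((Finset.range (u + 1)).filter fun a => O a u = true).card - 1 := by omega
    _ ≤ (((Finset.range (u + 1)).filter fun a => O a u = true).erase r).card :=
        Finset.pred_card_le_card_erase
    _ ≤ coreSize n O u r := by
        rw [coreSize, Nat.count_eq_card_filter_range]
        exact Finset.card_le_card hsub

/-! ### Symbol counts of random similarity matrices -/

section SideLaw

variable {n k q : ℕ}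

/-- The position of the similarity of `v` to another element. -/
def pairOf (v : Fin n) (a : {a : Fin n // (a : ℕ) ≠ v}) : Pair n :=
  ⟨(min v a, max v a), min_lt_max.2 fun h => a.2 (congrArg Fin.val h.symm)⟩

theorem pairOf_injective (v : Fin n) : (pairOf v).Injective := fun a b h => by
  have hmin : min v a = min v b := congrArg (fun p : Pair n => p.1.1) h
  have hmax : max v a = max v b := congrArg (fun p : Pair n => p.1.2) h
  rw [Fin.ext_iff, Fin.coe_min, Fin.coe_min] at hmin
  rw [Fin.ext_iff, Fin.coe_max, Fin.coe_max] at hmax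
  exact Subtype.ext (Fin.ext (by omega))

theorem sideArray_pos (W : Pair n → Fin q) (v : Fin n) (a : {a : Fin n // (a : ℕ) ≠ v}) :
    sideArray W (pos n v a) = W (pairOf v a) := by
  have hpos : pos n v a = (max v a : Fin n) + n * (min v a : Fin n) := by
    rw [pos, Fin.coe_max, Fin.coe_min, show (v : ℕ) - (v - a.1) = min (v : ℕ) a.1 by omega,
      show (v : ℕ) + (a.1 - v) = max (v : ℕ) a.1 by omega]
    ring
  have hdiv : pos n v a / n = (min v a : Fin n) := by
    rw [hpos, Nat.add_mul_div_left _ _ v.pos, Nat.div_eq_of_lt (Fin.is_lt _), zero_add]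
  have hmod : pos n v a % n = (max v a : Fin n) := by
    rw [hpos, Nat.add_mul_mod_self_left, Nat.mod_eq_of_lt (Fin.is_lt _)]
  have hlt := Fin.lt_def.1 (pairOf v a).2
  simp only [pairOf] at hlt ⊢
  rw [sideArray]
  simp only [hdiv, hmod]
  rw [dif_pos ⟨Fin.is_lt _, Fin.is_lt _, hlt⟩]

theorem sideArray_lt (hq : 0 < q) (W : Pair n → Fin q) (i : ℕ) : sideArray W i < q := by
  unfold sideArray
  split_ifs
  exacts [Fin.is_lt _, hq]

theorem coreCount_eq_zero {W : ℕ → ℕ} {x : ℕ} (h : ∀ i, W i < x) (O : ℕ → ℕ → Bool)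
    (u r v : ℕ) : coreCount n W O u r x v = 0 :=
  (Nat.count_iff_forall_not).2 fun _ _ h' => (h _).ne h'.2

instance (c : Fin n → Fin k) (fp fm : PMF (Fin q)) : IsProbabilityMeasure (sideLaw c fp fm) := by
  unfold sideLaw
  infer_instance

theorem coreCount_eq_sum {O : ℕ → ℕ → Bool} {u r : ℕ} {v : Fin n} (hv : ¬ InCore O u r v)
    (W : Pair n → Fin q) (x : Fin q) :
    (coreCount n (sideArray W) O u r x v : ℝ) =
      (∑ a ∈ Finset.univ.filter fun a : {a : Fin n // (a : ℕ) ≠ v} => InCore O u r a,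
        fun W : Pair n → Fin q => Set.indicator {x} (1 : Fin q → ℝ) (W (pairOf v a))) W := by
  rw [coreCount, count_eq_card_ne fun h => hv h.1, ← Finset.filter_filter, Finset.card_filter,
    Finset.sum_apply, Nat.cast_sum]
  refine Finset.sum_congr rfl fun a _ => ?_
  simp [sideArray_pos, Set.indicator_apply, Fin.ext_iff]

variable (c : Fin n → Fin k) (fp fm : PMF (Fin q))

theorem hasSubpoissonMGF_coreCount {u r v : Fin n} (hv : ¬ InCore (oracle c) u r v)
    (x : Fin q) :
    HasSubpoissonMGF (fun W => (coreCount n (sideArray W) (oracle c) u r x v : ℝ))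
      (coreSize n (oracle c) u r * ((if c v = c u then fp else fm) x).toReal)
      (sideLaw c fp fm) := by
  simp only [coreCount_eq_sum hv]
  rw [coreSize, count_eq_card_ne hv]
  refine hasSubpoissonMGF_sum_indicator_eval (measurableSet_singleton x) (pairOf_injective v)
    fun a ha => ?_
  have hau : c a = c u := ((inCore_oracle c).1 (Finset.mem_filter.1 ha).2).2.1
  have hpair : c (min v a) = c (max v a) ↔ c v = c u := by
    rw [← hau]
    rcases le_total v a with hle | hle
    · simp [min_eq_left hle, max_eq_right hle]
    · simp [min_eq_right hle, max_eq_left hle, eq_comm]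
  rw [pairOf, measureReal_def, PMF.toMeasure_apply_singleton _ _ (measurableSet_singleton x)]
  simp only [hpair]

/-- The counts for all clusters, elements and symbols are close to their expectations, on the scale
on which the square root is a variance-stabilising transformation. -/
def Concentrated (ρ : ℝ) (W : Pair n → Fin q) : Prop :=
  ∀ u r v : Fin n, ¬ InCore (oracle c) u r v → ∀ x : Fin q,
    |√(coreCount n (sideArray W) (oracle c) u r x v) -
      √(coreSize n (oracle c) u r * ((if c v = c u then fp else fm) x).toReal)| ≤ ρ

theorem measure_not_concentrated_le {ρ : ℝ} (hρ : 0 ≤ ρ) :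
    (sideLaw c fp fm).real {W | ¬ Concentrated c fp fm ρ W} ≤
      2 * q * n ^ 3 * Real.exp (-ρ ^ 2) := by
  set bad : (Fin n × Fin n × Fin n) × Fin q → Set (Pair n → Fin q) := fun z =>
    {W | ¬ InCore (oracle c) z.1.1 z.1.2.1 z.1.2.2 ∧
      ρ < |√(coreCount n (sideArray W) (oracle c) z.1.1 z.1.2.1 z.2 z.1.2.2) -
        √(coreSize n (oracle c) z.1.1 z.1.2.1 *
          ((if c z.1.2.2 = c z.1.1 then fp else fm) z.2).toReal)|}
  have hsub : {W | ¬ Concentrated c fp fm ρ W} ⊆ ⋃ z, bad z := by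
    intro W hW
    simp only [Concentrated, Set.mem_ofPred_eq, not_forall, not_le] at hW
    obtain ⟨u, r, v, hv, x, h⟩ := hW
    exact Set.mem_iUnion.2 ⟨((u, r, v), x), hv, h⟩
  have hle (z) : (sideLaw c fp fm).real (bad z) ≤ 2 * Real.exp (-ρ ^ 2) := by
    by_cases hv : InCore (oracle c) z.1.1 z.1.2.1 z.1.2.2
    · have hempty : bad z = ∅ := Set.eq_empty_of_forall_notMem fun W hW => hW.1 hv
      rw [hempty, measureReal_empty]
      positivity
    · exact (measureReal_mono fun W hW => hW.2).trans
        ((hasSubpoissonMGF_coreCount c fp fm hv z.2).measure_lt_abs_sqrt_sub_sqrt_le hρ)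
  calc (sideLaw c fp fm).real {W | ¬ Concentrated c fp fm ρ W}
      ≤ ∑ z, (sideLaw c fp fm).real (bad z) :=
        (measureReal_mono hsub).trans (measureReal_iUnion_fintype_le _)
    _ ≤ ∑ _z : (Fin n × Fin n × Fin n) × Fin q, 2 * Real.exp (-ρ ^ 2) :=
        Finset.sum_le_sum fun z _ => hle z
    _ = 2 * q * n ^ 3 * Real.exp (-ρ ^ 2) := by simp; ring

end SideLaw

section Far

theorem far_iff {τ a b : ℕ} : Far τ a b ↔ (τ : ℝ) * (a + b) < ((a : ℝ) - b) ^ 2 := by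
  have h : (((a - b + (b - a)) * (a - b + (b - a)) : ℕ) : ℝ) = ((a : ℝ) - b) ^ 2 := by
    rcases le_total a b with hab | hab
    · rw [Nat.sub_eq_zero_of_le hab, zero_add, Nat.cast_mul, Nat.cast_sub hab]
      ring
    · rw [Nat.sub_eq_zero_of_le hab, add_zero, Nat.cast_mul, Nat.cast_sub hab]
      ring
  rw [Far, ← Nat.cast_lt (α := ℝ), h, Nat.cast_mul, Nat.cast_add]

theorem sub_sq_eq_sqrt_sub_mul_sqrt_add {a b : ℝ} (ha : 0 ≤ a) (hb : 0 ≤ b) :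
    (a - b) ^ 2 = (√a - √b) ^ 2 * (√a + √b) ^ 2 := by
  rw [← mul_pow, mul_comm, ← sq_sub_sq, Real.sq_sqrt ha, Real.sq_sqrt hb]

variable {τ a b : ℕ} {ρ : ℝ}

theorem Far.lt_abs_sqrt_sub_sqrt (h : Far τ a b) (hρ : 2 * ρ ^ 2 ≤ τ) :
    ρ < |√(a : ℝ) - √b| := by
  refine lt_of_pow_lt_pow_left₀ 2 (abs_nonneg _) ?_
  rw [sq_abs]
  by_contra! hle
  refine (far_iff.1 h).not_ge ?_
  have hadd : (√(a : ℝ) + √b) ^ 2 ≤ 2 * (a + b) := by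
    simpa [Real.sq_sqrt] using add_sq_le (a := √(a : ℝ)) (b := √b)
  calc ((a : ℝ) - b) ^ 2 = (√a - √b) ^ 2 * (√a + √b) ^ 2 :=
        sub_sq_eq_sqrt_sub_mul_sqrt_add a.cast_nonneg b.cast_nonneg
    _ ≤ ρ ^ 2 * (2 * (a + b)) := by gcongr
    _ = 2 * ρ ^ 2 * (a + b) := by ring
    _ ≤ τ * (a + b) := by gcongr

theorem far_of_lt_abs_sqrt_sub_sqrt (hτ : τ ≤ ρ ^ 2) (hρ : 0 ≤ ρ) (h : ρ < |√(a : ℝ) - √b|) :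
    Far τ a b := by
  have hadd : (a + b : ℝ) ≤ (√a + √b) ^ 2 := by
    rw [add_sq, Real.sq_sqrt a.cast_nonneg, Real.sq_sqrt b.cast_nonneg]
    linarith [show 0 ≤ 2 * √(a : ℝ) * √b by positivity]
  have hpos : 0 < √(a : ℝ) + √b := (hρ.trans_lt h).trans_le <| by
    rw [abs_le']
    constructor <;> linarith [Real.sqrt_nonneg (a : ℝ), Real.sqrt_nonneg (b : ℝ)]
  rw [far_iff]
  calc (τ : ℝ) * (a + b) ≤ ρ ^ 2 * (√a + √b) ^ 2 := by gcongr
    _ < |√(a : ℝ) - √b| ^ 2 * (√a + √b) ^ 2 := by gcongr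
    _ = ((a : ℝ) - b) ^ 2 := by
      rw [sq_abs, ← sub_sq_eq_sqrt_sub_mul_sqrt_add a.cast_nonneg b.cast_nonneg]

end Far

section Hellinger

variable {q : ℕ} (f g : PMF (Fin q))

theorem sum_toReal_pmf : ∑ x, (f x).toReal = 1 := by
  rw [← ENNReal.toReal_sum fun x _ => f.apply_ne_top x, ← tsum_fintype (L := .unconditional _),
    f.tsum_coe, ENNReal.toReal_one]

theorem hellingerSq_nonneg : 0 ≤ hellingerSq f g := by
  unfold hellingerSq
  positivity

theorem hellingerSq_le_one : hellingerSq f g ≤ 1 := by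
  have hle (x) : (√(f x).toReal - √(g x).toReal) ^ 2 ≤ (f x).toReal + (g x).toReal := by
    rw [sub_sq, Real.sq_sqrt ENNReal.toReal_nonneg, Real.sq_sqrt ENNReal.toReal_nonneg]
    linarith [show 0 ≤ 2 * √(f x).toReal * √(g x).toReal by positivity]
  have hsum := Finset.sum_le_sum fun x (_ : x ∈ Finset.univ) => hle x
  rw [Finset.sum_add_distrib, sum_toReal_pmf, sum_toReal_pmf] at hsum
  unfold hellingerSq
  linarith

theorem pos_of_pmf (f : PMF (Fin q)) : 0 < q :=
  f.support_nonempty.choose.pos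

theorem exists_two_mul_hellingerSq_le :
    ∃ x, 2 * hellingerSq f g ≤ q * (√(f x).toReal - √(g x).toReal) ^ 2 := by
  have : NeZero q := ⟨(pos_of_pmf f).ne'⟩
  obtain ⟨x, -, hx⟩ := Finset.univ.exists_max_image
    (fun x => (√(f x).toReal - √(g x).toReal) ^ 2) Finset.univ_nonempty
  refine ⟨x, ?_⟩
  have hsum := Finset.sum_le_card_nsmul _ _ _ hx
  rw [Finset.card_univ, Fintype.card_fin, nsmul_eq_mul] at hsum
  unfold hellingerSq
  linarith

end Hellinger

/-! ### Separation with high probability -/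

section Separation

variable {n k q M : ℕ} {c : Fin n → Fin k} {fp fm : PMF (Fin q)} {ρ : ℝ} {W : Pair n → Fin q}

theorem not_inCore_self (O : ℕ → ℕ → Bool) (u r : ℕ) : ¬ InCore O u r r :=
  fun h => h.2.2 rfl

theorem Concentrated.abs_sqrt_sub_sqrt_le (hW : Concentrated c fp fm ρ W) {u r v w : Fin n}
    (hv : ¬ InCore (oracle c) u r v) (hw : ¬ InCore (oracle c) u r w)
    (hvw : c v = c u ↔ c w = c u) (x : Fin q) :
    |√(coreCount n (sideArray W) (oracle c) u r x v : ℝ) -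
      √(coreCount n (sideArray W) (oracle c) u r x w)| ≤ 2 * ρ := by
  have hNv := hW u r v hv x
  have hNw := hW u r w hw x
  simp only [hvw] at hNv
  rw [abs_sub_comm] at hNw
  exact (abs_sub_le _ _ _).trans (by linarith)

theorem Concentrated.not_far_iff (hW : Concentrated c fp fm √(5 * n.size) W) {u r v w : Fin n}
    (hr : c r = c u) (hv : ¬ InCore (oracle c) u r v) (hw : ¬ InCore (oracle c) u r w) {x : Fin q}
    (hfar : Far (500 * n.size) (coreCount n (sideArray W) (oracle c) u r x w)
      (coreCount n (sideArray W) (oracle c) u r x r)) :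
    ¬ Far (40 * n.size) (coreCount n (sideArray W) (oracle c) u r x v)
      (coreCount n (sideArray W) (oracle c) u r x r) ↔ c v = c u := by
  set ρ := √(5 * (n.size : ℝ))
  set N : Fin n → ℝ := fun v => √(coreCount n (sideArray W) (oracle c) u r x v : ℝ)
  have hρ0 : 0 ≤ ρ := Real.sqrt_nonneg _
  have hρ : ρ ^ 2 = 5 * n.size := Real.sq_sqrt (by positivity)
  have hr' := not_inCore_self (oracle c) u r
  have hwr : 7 * ρ < |N w - N r| := by
    refine hfar.lt_abs_sqrt_sub_sqrt ?_
    push_cast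
    linarith
  have hwu : c w ≠ c u := fun h => by
    have := hW.abs_sqrt_sub_sqrt_le hw hr' (by simp [h, hr]) x
    linarith
  refine ⟨fun hnot => ?_, fun h hfar' => ?_⟩
  · by_contra h
    have hvw : |N w - N v| ≤ 2 * ρ := hW.abs_sqrt_sub_sqrt_le hw hv (by simp [h, hwu]) x
    refine hnot (far_of_lt_abs_sqrt_sub_sqrt (ρ := 3 * ρ) ?_ (by positivity) ?_)
    · push_cast
      linarith
    · linarith [abs_sub_le (N w) (N v) (N r)]
  · have hvr : |N v - N r| ≤ 2 * ρ := hW.abs_sqrt_sub_sqrt_le hv hr' (by simp [h, hr]) x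
    refine hvr.not_gt (hfar'.lt_abs_sqrt_sub_sqrt ?_)
    push_cast
    linarith

theorem exists_le_sqrt_mul_abs_sub {s : ℝ} {L : ℕ} (hs : 500 * q * L ≤ s * hellingerSq fp fm) :
    ∃ x, √(1000 * L) ≤ √s * |√(fp x).toReal - √(fm x).toReal| := by
  obtain ⟨x, hx⟩ := exists_two_mul_hellingerSq_le fp fm
  have hq : (0 : ℝ) < q := Nat.cast_pos.2 (pos_of_pmf fp)
  rcases le_total s 0 with hs0 | hs0
  · have hL : (L : ℝ) ≤ 0 := by
      have := hs.trans (mul_nonpos_of_nonpos_of_nonneg hs0 (hellingerSq_nonneg fp fm))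
      nlinarith
    refine ⟨x, (Real.sqrt_eq_zero_of_nonpos (by linarith)).trans_le (by positivity)⟩
  · refine ⟨x, ?_⟩
    rw [← Real.sqrt_sq_eq_abs, ← Real.sqrt_mul hs0]
    refine Real.sqrt_le_sqrt (le_of_mul_le_mul_left ?_ hq)
    calc q * (1000 * (L : ℝ)) = 2 * (500 * q * L) := by ring
      _ ≤ 2 * (s * hellingerSq fp fm) := by gcongr
      _ = s * (2 * hellingerSq fp fm) := by ring
      _ ≤ s * (q * (√(fp x).toReal - √(fm x).toReal) ^ 2) := by gcongr
      _ = q * (s * (√(fp x).toReal - √(fm x).toReal) ^ 2) := by ring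

theorem Concentrated.exists_far (hW : Concentrated c fp fm √(5 * n.size) W) {u r v : Fin n}
    (hr : c r = c u) (hv : c v ≠ c u)
    (hs : 500 * q * n.size ≤ coreSize n (oracle c) u r * hellingerSq fp fm) :
    ∃ x : Fin q, Far (500 * n.size) (coreCount n (sideArray W) (oracle c) u r x v)
      (coreCount n (sideArray W) (oracle c) u r x r) := by
  set ρ := √(5 * (n.size : ℝ))
  have hsize : (0 : ℝ) < n.size := Nat.cast_pos.2 (Nat.size_pos.2 u.pos)
  have hρ0 : 0 < ρ := Real.sqrt_pos.2 (by positivity)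
  have hρ : ρ ^ 2 = 5 * n.size := Real.sq_sqrt (by positivity)
  obtain ⟨x, hx⟩ := exists_le_sqrt_mul_abs_sub hs
  have hgap : 14 * ρ ≤ √(1000 * n.size) := Real.le_sqrt_of_sq_le (by nlinarith)
  have hNr := hW u r r (not_inCore_self _ _ _) x
  have hNv := hW u r v (fun h => hv ((inCore_oracle c).1 h).2.1) x
  rw [if_pos hr, Real.sqrt_mul (Nat.cast_nonneg _)] at hNr
  rw [if_neg hv, Real.sqrt_mul (Nat.cast_nonneg _), abs_sub_comm] at hNv
  refine ⟨x, far_of_lt_abs_sqrt_sub_sqrt (ρ := 10 * ρ) ?_ (by positivity) ?_⟩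
  · push_cast
    linarith
  · rw [← abs_of_nonneg (Real.sqrt_nonneg (coreSize n (oracle c) u r : ℝ)), ← abs_mul, mul_sub,
      abs_sub_comm] at hx
    have hvr := abs_sub_le (√(coreSize n (oracle c) u r : ℝ) * √(fm x).toReal)
      √(coreCount n (sideArray W) (oracle c) u r x v : ℝ)
      √(coreCount n (sideArray W) (oracle c) u r x r : ℝ)
    have hrs := abs_sub_le (√(coreSize n (oracle c) u r : ℝ) * √(fm x).toReal)
      √(coreCount n (sideArray W) (oracle c) u r x r : ℝ)
      (√(coreSize n (oracle c) u r : ℝ) * √(fp x).toReal)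
    linarith

theorem Concentrated.separates (hW : Concentrated c fp fm √(5 * n.size) W) (hqn : q ≤ n)
    (hM : n ≤ M ∨ (∀ u, ∃ v, c v ≠ c u) ∧ 500 * q * n.size ≤ M * hellingerSq fp fm) :
    Separates n (sideArray W) (oracle c) M where
  separates u hu r hr hru x w hw hwu hfar v hv hvu := by
    lift u to Fin n using hu
    lift r to Fin n using hr
    lift w to Fin n using hw
    lift v to Fin n using hv
    have hx : x < q := by
      by_contra! hx
      have hW0 (i) : sideArray W i < x := (sideArray_lt (pos_of_pmf fp) W i).trans_le hx
      simp [coreCount_eq_zero hW0, Far] at hfar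
    lift x to Fin q using hx
    rw [oracle_val] at hru ⊢
    exact hW.not_far_iff hru hvu hwu hfar
  ready u hu r hr hru hMu := by
    rcases hM with hM | ⟨hne, hM⟩
    · have : rank (oracle c) u u ≤ u := Nat.count_le _
      omega
    · lift u to Fin n using hu
      lift r to Fin n using hr
      obtain ⟨v, hv⟩ := hne u
      have hsize : (M : ℝ) ≤ coreSize n (oracle c) u r :=
        mod_cast hMu.trans (rank_le_coreSize (isEquivalenceOracle_oracle c) u.2 r)
      obtain ⟨x, hx⟩ := hW.exists_far ((oracle_val c r u).1 hru) hv
        (hM.trans (mul_le_mul_of_nonneg_right hsize (hellingerSq_nonneg fp fm)))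
      exact ⟨v, v.2, by rwa [← Bool.not_eq_true, oracle_val], x, x.2.trans_le hqn, hx⟩

end Separation

/-! ### Runs of the clustering program -/

section Runs

variable {n k q M : ℕ} {c : Fin n → Fin k} {fp fm : PMF (Fin q)} {W : Pair n → Fin q}

theorem haltsIn_mainCmd (conf : Bool) (c : Fin n → Fin k) (W : Pair n → Fin q) (ω : ℕ → Bool) :
    ∃ t, HaltsIn (Cmd.mainCmd conf).toProg c W ω t ∧
      t.mem 2 = (stages n (sideArray W) (oracle c) conf n).labels ∧
      t.queries = (stages n (sideArray W) (oracle c) conf n).queries :=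
  have hrun := represents_final conf c W
  ⟨_, Cmd.haltsIn_after (Cmd.ok_mainCmd conf) c W ω, hrun.labels_eq, hrun.queries_eq⟩

theorem Consistent.recovers {t : State} (h : Consistent n (oracle c) (t.mem 2))
    (hlabelled : ∀ v < n, t.mem 2 v ≠ 0) : Recovers t c := fun u v =>
  (h.label_eq_iff (isEquivalenceOracle_oracle c) u.2 v.2 (hlabelled u u.2) (hlabelled v v.2)).trans
    (oracle_val c u v)

theorem exists_haltsIn_recovers (c : Fin n → Fin k) (W : Pair n → Fin q) (ω : ℕ → Bool) :
    ∃ t, HaltsIn (Cmd.mainCmd true).toProg c W ω t ∧ Recovers t c := by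
  obtain ⟨t, ht, hmem, -⟩ := haltsIn_mainCmd true c W ω
  have h := consistent_stages_true (W := sideArray W) (isEquivalenceOracle_oracle c) le_rfl
  rw [← hmem] at h
  exact ⟨t, ht, h.1.recovers h.2⟩

theorem Separates.exists_haltsIn (hW : Separates n (sideArray W) (oracle c) M) (conf : Bool)
    (ω : ℕ → Bool) :
    ∃ t, HaltsIn (Cmd.mainCmd conf).toProg c W ω t ∧ Recovers t c ∧
      t.queries ≤ (Finset.univ.image c).card * earlyCount (oracle c) M n +
        if conf then n else 0 := by
  have hO := isEquivalenceOracle_oracle c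
  have hK (f) (h : Consistent n (oracle c) f) := h.repCount_le
  obtain ⟨t, ht, hmem, hq⟩ := haltsIn_mainCmd conf c W ω
  have hinv := (hW.stageInvariant_stages hO hK conf le_rfl).1
  rw [← hmem] at hinv
  exact ⟨t, ht, hinv.consistent.recovers hinv.labelled,
    hq.trans_le (hW.queries_stages_le hO hK conf)⟩

theorem queryBound_nonneg (n k : ℕ) {h : ℝ} (hh : 0 ≤ h) : 0 ≤ queryBound n k h := by
  have := Real.log_natCast_nonneg n
  unfold queryBound
  split_ifs <;> positivity

theorem mul_le_mul_queryBound {h e C : ℝ} (hC : 1 ≤ C) (hn : e ≤ n)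
    (hk : h ≠ 0 → e ≤ k * (C * Real.log n / h)) : k * e ≤ C * queryBound n k h := by
  have hnk : k * e ≤ C * (n * k) := by
    calc k * e ≤ k * n := by gcongr
      _ = 1 * (n * k) := by ring
      _ ≤ C * (n * k) := by gcongr
  unfold queryBound
  split_ifs with h0
  · exact hnk
  · rw [mul_min_of_nonneg _ _ (by positivity)]
    refine le_min hnk ?_
    calc k * e ≤ k * (k * (C * Real.log n / h)) := by gcongr; exact hk h0
      _ = C * (k ^ 2 * Real.log n / h) := by ring

theorem two_pow_size_le (hn : n ≠ 0) : 2 ^ n.size ≤ 2 * n := by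
  obtain ⟨m, hm⟩ := Nat.exists_eq_succ_of_ne_zero (Nat.size_pos.2 (Nat.pos_of_ne_zero hn)).ne'
  rw [hm, pow_succ, mul_comm]
  exact Nat.mul_le_mul_left 2 (Nat.lt_size.1 (by omega))

theorem size_le_log (hn : 2 ≤ n) : (n.size : ℝ) ≤ 4 * Real.log n := by
  have hpow : (2 : ℝ) ^ n.size ≤ n ^ 2 := by
    have := (two_pow_size_le (by omega : n ≠ 0)).trans (Nat.mul_le_mul_right n hn)
    exact_mod_cast this.trans_eq (sq n).symm
  have hlog := Real.log_le_log (by positivity) hpow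
  rw [Real.log_pow, Real.log_pow] at hlog
  have hlog2 : (1 / 2 : ℝ) ≤ Real.log 2 := by linarith [Real.log_two_gt_d9]
  have := mul_le_mul_of_nonneg_left hlog2 n.size.cast_nonneg
  push_cast at hlog
  linarith

theorem ceil_add_one_le (hn : 2 ≤ n) (q : ℕ) {h : ℝ} (h0 : 0 < h) (h1 : h ≤ 1) :
    (⌈500 * q * n.size / h⌉₊ : ℝ) + 1 ≤ (2000 * q + 8) * Real.log n / h := by
  have hsize : (1 : ℝ) ≤ n.size := Nat.one_le_cast.2 (Nat.size_pos.2 (by omega))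
  have hceil := Nat.ceil_lt_add_one (a := 500 * q * n.size / h) (by positivity)
  have hdiv : 1 ≤ n.size / h := (one_le_div h0).2 (h1.trans hsize)
  calc (⌈500 * q * n.size / h⌉₊ : ℝ) + 1 ≤ 500 * q * n.size / h + 2 * (n.size / h) := by linarith
    _ = (500 * q + 2) * n.size / h := by ring
    _ ≤ (500 * q + 2) * (4 * Real.log n) / h := by gcongr; exact size_le_log hn
    _ = (2000 * q + 8) * Real.log n / h := by ring

theorem Concentrated.exists_separates (hW : Concentrated c fp fm √(5 * n.size) W)
    (hn : q + 3 ≤ n) (hc : ∀ u, ∃ v, c v ≠ c u) :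
    ∃ M, Separates n (sideArray W) (oracle c) M ∧ (k * earlyCount (oracle c) M n : ℝ) ≤
      (2000 * q + 8) * queryBound n k (hellingerSq fp fm) := by
  set h := hellingerSq fp fm
  have hC : (1 : ℝ) ≤ 2000 * q + 8 := by linarith [q.cast_nonneg (α := ℝ)]
  have hearly (M) : (earlyCount (oracle c) M n : ℝ) ≤ n := mod_cast Nat.count_le _
  rcases (hellingerSq_nonneg fp fm).eq_or_lt' with h0 | h0
  · exact ⟨n, hW.separates (by omega) (.inl le_rfl),
      mul_le_mul_queryBound hC (hearly n) fun h0' => absurd h0 h0'⟩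
  · set M := ⌈500 * q * n.size / h⌉₊
    have hM : (500 * q * n.size : ℝ) ≤ M * h := (div_le_iff₀ h0).1 (Nat.le_ceil _)
    refine ⟨M, hW.separates (by omega) (.inr ⟨hc, hM⟩), mul_le_mul_queryBound hC (hearly M)
      fun _ => ?_⟩
    calc (earlyCount (oracle c) M n : ℝ) ≤ k * (M + 1) := mod_cast earlyCount_le c M
      _ ≤ k * ((2000 * q + 8) * Real.log n / h) := by
        gcongr
        exact ceil_add_one_le (by omega) q h0 (hellingerSq_le_one fp fm)

theorem Concentrated.exists_haltsIn (hW : Concentrated c fp fm √(5 * n.size) W)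
    (hn : q + 3 ≤ n) (hc : ∀ u, ∃ v, c v ≠ c u) (conf : Bool) (ω : ℕ → Bool) :
    ∃ t, HaltsIn (Cmd.mainCmd conf).toProg c W ω t ∧ Recovers t c ∧
      (t.queries : ℝ) ≤ (2000 * q + 8) * queryBound n k (hellingerSq fp fm) +
        if conf then (n : ℝ) else 0 := by
  obtain ⟨M, hsep, hM⟩ := hW.exists_separates hn hc
  obtain ⟨t, ht, hrec, hq⟩ := hsep.exists_haltsIn conf ω
  have hk : (Finset.univ.image c).card ≤ k := by
    simpa using (Finset.univ.image c).card_le_univ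
  have hq' := hq.trans (Nat.add_le_add_right (Nat.mul_le_mul_right _ hk) _)
  refine ⟨t, ht, hrec, le_trans ?_ (add_le_add_left hM _)⟩
  exact_mod_cast hq'

theorem one_le_log (hn : 3 ≤ n) : 1 ≤ Real.log n := by
  rw [Real.le_log_iff_exp_le (by positivity)]
  linarith [Real.exp_one_lt_d9, show (3 : ℝ) ≤ n from mod_cast hn]

theorem Concentrated.exists_haltsIn_true (hW : Concentrated c fp fm √(5 * n.size) W)
    (hn : q + 3 ≤ n) (ω : ℕ → Bool) :
    ∃ t, HaltsIn (Cmd.mainCmd true).toProg c W ω t ∧ (t.queries : ℝ) ≤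
      (2000 * q + 8) * (n * Real.log n + queryBound n k (hellingerSq fp fm)) := by
  have hB := queryBound_nonneg n k (hellingerSq_nonneg fp fm)
  have hlog : (n : ℝ) ≤ n * Real.log n :=
    le_mul_of_one_le_right n.cast_nonneg (one_le_log (by omega))
  have : (0 : ℝ) ≤ q := q.cast_nonneg
  by_cases hc : ∀ u, ∃ v, c v ≠ c u
  · obtain ⟨t, ht, -, hq⟩ := hW.exists_haltsIn hn hc true ω
    refine ⟨t, ht, hq.trans ?_⟩
    rw [if_pos rfl]
    nlinarith
  · push Not at hc
    obtain ⟨u, hu⟩ := hc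
    have himage : (Finset.univ.image c).card ≤ 1 := by
      simp [Finset.card_le_one, hu]
    obtain ⟨t, ht, -, hq⟩ := (hW.separates (by omega) (.inl le_rfl)).exists_haltsIn true ω
    refine ⟨t, ht, ?_⟩
    have hq' : (t.queries : ℝ) ≤ 1 * n + n :=
      mod_cast hq.trans (Nat.add_le_add_right (Nat.mul_le_mul himage (Nat.count_le _)) _)
    nlinarith

theorem exists_ne_of_card_le {ε : ℝ} (hε : 0 < ε)
    (hc : ∀ i, ((Finset.univ.filter fun v => c v = i).card : ℝ) ≤ (1 - ε) * n) (u : Fin n) :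
    ∃ v, c v ≠ c u := by
  by_contra! h
  have hcard := hc (c u)
  rw [Finset.filter_true_of_mem fun v _ => h v, Finset.card_univ, Fintype.card_fin] at hcard
  have hn : (0 : ℝ) < n := Nat.cast_pos.2 u.pos
  nlinarith

end Runs

/-! ### The failure probability -/

/-- Bound for the failure probability of the algorithm, trivial for small `n`. -/
noncomputable def failureBound (q n : ℕ) : ℝ := if n < q + 3 then 1 else 2 * q / n ^ 2

theorem isLittleO_failureBound (q : ℕ) :
    Asymptotics.IsLittleO Filter.atTop (failureBound q) (fun n : ℕ => 1 / (n : ℝ)) := by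
  have heq : (fun n : ℕ => (2 * q : ℝ) * (1 / (n : ℝ) * (1 / n))) =ᶠ[Filter.atTop]
      failureBound q := by
    filter_upwards [Filter.eventually_ge_atTop (q + 3)] with n hn
    rw [failureBound, if_neg (by omega)]
    field_simp
  have hone : Asymptotics.IsLittleO Filter.atTop (fun n : ℕ => 1 / (n : ℝ)) fun _ => (1 : ℝ) :=
    (Asymptotics.isLittleO_one_iff ℝ).2 tendsto_one_div_atTop_nhds_zero_nat
  refine Asymptotics.IsLittleO.congr' (Asymptotics.IsLittleO.const_mul_left ?_ _) heq .rfl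
  simpa using (Asymptotics.isBigO_refl (fun n : ℕ => 1 / (n : ℝ)) Filter.atTop).mul_isLittleO hone

theorem pow_le_exp_mul_size (n m : ℕ) : (n : ℝ) ^ m ≤ Real.exp (m * n.size) := by
  have hexp : (2 : ℝ) ≤ Real.exp 1 := by linarith [Real.add_one_le_exp (1 : ℝ)]
  calc (n : ℝ) ^ m ≤ ((2 : ℝ) ^ n.size) ^ m := by
        gcongr
        exact_mod_cast n.lt_size_self.le
    _ ≤ (Real.exp 1 ^ n.size) ^ m := by gcongr
    _ = Real.exp (m * n.size) := by rw [← pow_mul, ← Real.exp_nat_mul, mul_one, mul_comm]; simp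

instance : IsProbabilityMeasure coinLaw := by
  unfold coinLaw
  infer_instance

instance {n k q : ℕ} (c : Fin n → Fin k) (fp fm : PMF (Fin q)) :
    IsProbabilityMeasure (jointLaw c fp fm) := by
  unfold jointLaw
  infer_instance

theorem jointLaw_le_failureBound {n k q : ℕ} (c : Fin n → Fin k) (fp fm : PMF (Fin q))
    {E : Set ((Pair n → Fin q) × (ℕ → Bool))}
    (hE : q + 3 ≤ n → ∀ x ∈ E, ¬ Concentrated c fp fm √(5 * n.size) x.1) :
    (jointLaw c fp fm).real E ≤ failureBound q n := by
  unfold failureBound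
  split_ifs with hn
  · exact measureReal_le_one
  · have hsub : E ⊆ {W | ¬ Concentrated c fp fm √(5 * n.size) W} ×ˢ Set.univ :=
      fun x hx => ⟨hE (by omega) x hx, Set.mem_univ _⟩
    have hn0 : (0 : ℝ) < n := Nat.cast_pos.2 (by omega)
    calc (jointLaw c fp fm).real E
        ≤ (sideLaw c fp fm).real {W | ¬ Concentrated c fp fm √(5 * n.size) W} := by
          refine (measureReal_mono hsub).trans_eq ?_
          rw [jointLaw, measureReal_prod_prod, probReal_univ, mul_one]
      _ ≤ 2 * q * n ^ 3 * Real.exp (-√(5 * n.size) ^ 2) :=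
          measure_not_concentrated_le c fp fm (Real.sqrt_nonneg _)
      _ = 2 * q * n ^ 3 / Real.exp ((5 : ℕ) * n.size) := by
          rw [Real.sq_sqrt (by positivity), Real.exp_neg, div_eq_mul_inv, Nat.cast_ofNat]
      _ ≤ 2 * q * n ^ 3 / n ^ 5 := by gcongr; exact pow_le_exp_mul_size n 5
      _ = 2 * q / n ^ 2 := by field_simp

end QueryCluster

open QueryCluster in
theorem theorem1_general (q : ℕ) :
    (∃ P : Prog, PolyTime q P ∧ ∃ (C : ℝ) (δ : ℕ → ℝ),
      Asymptotics.IsLittleO Filter.atTop δ (fun n : ℕ => 1 / (n : ℝ)) ∧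
        ∀ (n k : ℕ) (c : Fin n → Fin k) (fp fm : PMF (Fin q)), (∀ u, ∃ v, c v ≠ c u) →
          (jointLaw c fp fm).real {x | ¬ ∃ t, HaltsIn P c x.1 x.2 t ∧ Recovers t c ∧
            (t.queries : ℝ) ≤ C * queryBound n k (hellingerSq fp fm)} ≤ δ n) ∧
    ∃ P : Prog, PolyTime q P ∧
      (∀ (n k : ℕ) (c : Fin n → Fin k) (W : Pair n → Fin q) (ω : ℕ → Bool),
        ∃ t, HaltsIn P c W ω t ∧ Recovers t c) ∧
      ∃ (C : ℝ) (δ : ℕ → ℝ), Asymptotics.IsLittleO Filter.atTop δ (fun n : ℕ => 1 / (n : ℝ)) ∧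
        ∀ (n k : ℕ) (c : Fin n → Fin k) (fp fm : PMF (Fin q)),
          (jointLaw c fp fm).real {x | ¬ ∃ t, HaltsIn P c x.1 x.2 t ∧
            (t.queries : ℝ) ≤
              C * (n * Real.log n + queryBound n k (hellingerSq fp fm))} ≤ δ n := by
  refine ⟨⟨_, Cmd.polyTime_toProg (Cmd.ok_mainCmd false) q, 2000 * q + 8, failureBound q,
      isLittleO_failureBound q, fun n k c fp fm hc => ?_⟩,
    _, Cmd.polyTime_toProg (Cmd.ok_mainCmd true) q, fun n k c W ω => exists_haltsIn_recovers c W ω,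
    2000 * q + 8, failureBound q, isLittleO_failureBound q, fun n k c fp fm => ?_⟩
  · refine jointLaw_le_failureBound c fp fm fun hn x hx hW => hx ?_
    simpa using hW.exists_haltsIn hn hc false x.2
  · exact jointLaw_le_failureBound c fp fm fun hn x hx hW => hx (hW.exists_haltsIn_true hn x.2)

theorem theorem1 (q : ℕ) :
    -- Monte Carlo algorithm, for clusters that contain at most a fraction `1 - ε` of the elements
    (∀ ε : ℝ, 0 < ε →
      ∃ P : QueryCluster.Prog, QueryCluster.PolyTime q P ∧
        ∃ (C : ℝ) (δ : ℕ → ℝ), Asymptotics.IsLittleO Filter.atTop δ (fun n : ℕ => 1 / (n : ℝ)) ∧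
          ∀ (n k : ℕ) (c : Fin n → Fin k) (fp fm : PMF (Fin q)), Function.Surjective c →
            (∀ i : Fin k, ((Finset.univ.filter fun v => c v = i).card : ℝ) ≤ (1 - ε) * n) →
            (QueryCluster.jointLaw c fp fm).real
              {x | ¬ ∃ t, QueryCluster.HaltsIn P c x.1 x.2 t ∧ QueryCluster.Recovers t c ∧
                (t.queries : ℝ) ≤
                  C * QueryCluster.queryBound n k (QueryCluster.hellingerSq fp fm)} ≤ δ n) ∧
    -- Las Vegas algorithm
    (∃ P : QueryCluster.Prog, QueryCluster.PolyTime q P ∧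
      (∀ (n k : ℕ) (c : Fin n → Fin k) (W : QueryCluster.Pair n → Fin q) (ω : ℕ → Bool),
        ∃ t, QueryCluster.HaltsIn P c W ω t ∧ QueryCluster.Recovers t c) ∧
      ∃ (C : ℝ) (δ : ℕ → ℝ), Asymptotics.IsLittleO Filter.atTop δ (fun n : ℕ => 1 / (n : ℝ)) ∧
        ∀ (n k : ℕ) (c : Fin n → Fin k) (fp fm : PMF (Fin q)), Function.Surjective c →
          (QueryCluster.jointLaw c fp fm).real
            {x | ¬ ∃ t, QueryCluster.HaltsIn P c x.1 x.2 t ∧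
              (t.queries : ℝ) ≤
                C * (n * Real.log n +
                  QueryCluster.queryBound n k (QueryCluster.hellingerSq fp fm))} ≤ δ n) := by
  obtain ⟨⟨P, hP, C, δ, hδ, hmain⟩, Q, hQ, hcorrect, D, η, hη, hmain'⟩ := theorem1_general q
  exact ⟨fun ε hε => ⟨P, hP, C, δ, hδ, fun n k c fp fm _ hc =>
    hmain n k c fp fm (QueryCluster.exists_ne_of_card_le hε hc)⟩,
    Q, hQ, hcorrect, D, η, hη, fun n k c fp fm _ => hmain' n k c fp fm⟩
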